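/- Let $\mathfrak g\subset\mathfrak{gl}_7(\mathbb C)$ be the simple Lie algebra of type $G_2$, consisting of the matrices $$\begin{pmatrix} h_2&e_2&-e_3&2e_4&-6e_5&6e_6&0\\ f_2&h_1-h_2&e_1&e_3&-2e_4&0&6e_6\\ f_3&f_1&-h_1+2h_2&e_2&0&-2e_4&6e_5\\ 4f_4&-2f_3&2f_2&0&2e_2&-2e_3&4e_4\\ 6f_5&-2f_4&0&f_2&h_1-2h_2&e_1&e_3\\ 6f_6&0&-2f_4&f_3&f_1&-h_1+h_2&e_2\\ 0&6f_6&-6f_5&2f_4&-f_3&f_2&-h_2\end{pmatrix}=\sum_i h_iH_i+\sum_i e_iE_i+\sum_i f_iF_i ,$$ with Killing form $(\cdot,\cdot)$. Let $A=F_6$, $B=E_1+E_2$, and let $\mathcal S$ be the affine space of all $$S=B+h\,(2H_1+H_2)+f_1F_1+f_3F_3+f_4F_4+f_5F_5+f_6F_6,\qquad h,f_i\in C^\infty(S^1,\mathbb C).$$ Let $\widetilde{\mathfrak g}$ be the Lie algebra of formal Laurent series in $\lambda^{-1}$ (finitely many positive powers of $\lambda$) with coefficients in $C^\infty(S^1,\mathfrak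 g)$, and put $\langle X,Y\rangle=\int_{S^1}(X,Y)\,dx$, extended to Laurent series in $\lambda^{-1}$ so that it takes values in $\mathbb C((\lambda^{-1}))$. Let $\mathfrak H\subset\widetilde{\mathfrak g}$ be the isotropy subalgebra of $B+\lambda A$ (the Heisenberg subalgebra modulo the centre), and for $n\in\mathbb Z$ put $$\Lambda^{6n+1}=\lambda^n(B+\lambda A),\qquad \Lambda^{6n-1}=\lambda^{n-1}(B+\lambda A)^5 .$$ Give $\lambda$ degree $6$ and the $(i,j)$ matrix unit degree $j-i$. A *dressing* of $S\in\mathcal S$ is a series $T=\exp U$, with $U\in\widetilde{\mathfrak g}$ of strictly negative degree, such that $$T(-\partial_x+S+\lambda A)T^{-1}=-\partial_x+(B+\lambda A)+H\quad\text{for some } H\in\mathfrak H .$$ **Proposition.** Every $S\in\mathcal S$ has a dressing $T$. Let $C=\sum_{j\equiv\pm1\,(6)}c_j\Lambda^{-j}$ with $c_j\in\mathbb C$, $c_j=0$ for all sufficiently negative $j$. Then $C\in\mathfrak H$, and: 1. For every $S\in\mathcal S$ and every dressing $T$ of $S$, the element $V_C=T^{-1}CT$ lies in $\widetilde{\mathfrak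 g}$ and solves the Casimir equation $V_x+[V,S+\lambda A]=0$. 2. The Hamiltonian of $V_C$ on $\mathcal S$ is $H_C=\langle J,C\rangle$, where $J=T(S+\lambda A)T^{-1}+T_xT^{-1}\in\widetilde{\mathfrak g}$. That is, $H_C$ depends only on $S$ and not on the dressing $T$, and along every smooth curve $t\mapsto S(t)$ in $\mathcal S$ (jointly smooth in $t$ and $x$) one has, coefficient by coefficient in $\lambda$, $\frac{d}{dt}H_C(S(t))=\langle \dot S(t),V_C\rangle$, with $V_C$ formed at $S(t)$. 3. For $j=6n\pm1$ and $C=\Lambda^j$, write $V^j=T^{-1}\Lambda^jT$ and let $V_j=\operatorname{res}V^j$ be the coefficient of $\lambda^{-1}$ in $V^j$. Then, for either choice of sign, $$V^{6n\pm1}=\lambda^n\sum_{p\ge-2}\frac1{\lambda^{p+1}}\,V_{6p\pm1}.$$ -/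

import Mathlib

open scoped ContDiff

namespace G2Loop

noncomputable section

/-! ## The Lie algebra of type G₂ in its seven-dimensional representation -/

/-- The general element
`h₁ H₁ + h₂ H₂ + ∑ eᵢ Eᵢ + ∑ fᵢ Fᵢ` of the Lie algebra of type `G₂`, as a `7 × 7` matrix. -/
def g2Matrix {R : Type*} [CommRing R] (h : Fin 2 → R) (e f : Fin 6 → R) :
    Matrix (Fin 7) (Fin 7) R :=
  !![h 1, e 1, -e 2, 2 * e 3, -6 * e 4, 6 * e 5, 0;
     f 1, h 0 - h 1, e 0, e 2, -2 * e 3, 0, 6 * e 5;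
     f 2, f 0, -h 0 + 2 * h 1, e 1, 0, -2 * e 3, 6 * e 4;
     4 * f 3, -2 * f 2, 2 * f 1, 0, 2 * e 1, -2 * e 2, 4 * e 3;
     6 * f 4, -2 * f 3, 0, f 1, h 0 - 2 * h 1, e 0, e 2;
     6 * f 5, 0, -2 * f 3, f 2, f 0, -h 0 + h 1, e 1;
     0, 6 * f 5, -6 * f 4, 2 * f 3, -f 2, f 1, -h 1]

attribute [local instance 100] LieRing.ofAssociativeRing

theorem g2Matrix_add (h h' : Fin 2 → ℂ) (e f e' f' : Fin 6 → ℂ) :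
    g2Matrix h e f + g2Matrix h' e' f' = g2Matrix (h + h') (e + e') (f + f') := by
  ext i j
  fin_cases i <;> fin_cases j <;> simp [g2Matrix] <;> ring

theorem g2Matrix_smul (c : ℂ) (h : Fin 2 → ℂ) (e f : Fin 6 → ℂ) :
    c • g2Matrix h e f = g2Matrix (c • h) (c • e) (c • f) := by
  ext i j
  fin_cases i <;> fin_cases j <;> simp [g2Matrix] <;> ring

theorem g2Matrix_lie (h h' : Fin 2 → ℂ) (e f e' f' : Fin 6 → ℂ) :
    ∃ h'' e'' f'', ⁅g2Matrix h e f, g2Matrix h' e' f'⁆ = g2Matrix h'' e'' f'' := by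
  refine ⟨
      ![e 0 * f' 0 - 3 * e 2 * f' 2 + 12 * e 3 * f' 3 - 36 * e 4 * f' 4 + 72 * e 5 * f' 5 - e' 0 *
      f 0 + 3 * e' 2 * f 2 - 12 * e' 3 * f 3 + 36 * e' 4 * f 4 - 72 * e' 5 * f 5,
      e 1 * f' 1 - e 2 * f' 2 + 8 * e 3 * f' 3 - 36 * e 4 * f' 4 + 36 * e 5 * f' 5 - e' 1 * f 1 +
      e' 2 * f 2 - 8 * e' 3 * f 3 + 36 * e' 4 * f 4 - 36 * e' 5 * f 5],
      ![-2 * e 0 * h' 0 + 3 * e 0 * h' 1 + 3 * e 2 * f' 1 - 36 * e 5 * f' 4 + 2 * e' 0 * h 0 - 3 *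
      e' 0 * h 1 - 3 * e' 2 * f 1 + 36 * e' 5 * f 4,
      e 1 * h' 0 - 2 * e 1 * h' 1 - e 2 * f' 0 - 4 * e 3 * f' 2 + 12 * e 4 * f' 3 - e' 1 * h 0 + 2
      * e' 1 * h 1 + e' 2 * f 0 + 4 * e' 3 * f 2 - 12 * e' 4 * f 3,
      e 0 * e' 1 - e 1 * e' 0 - e 2 * h' 0 + e 2 * h' 1 - 4 * e 3 * f' 1 + 12 * e 5 * f' 3 + e' 2
      * h 0 - e' 2 * h 1 + 4 * e' 3 * f 1 - 12 * e' 5 * f 3,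
      e 1 * e' 2 - e 2 * e' 1 - e 3 * h' 1 - 3 * e 4 * f' 1 + 3 * e 5 * f' 2 + e' 3 * h 1 + 3 * e'
      4 * f 1 - 3 * e' 5 * f 2,
      e 1 * e' 3 - e 3 * e' 1 + e 4 * h' 0 - 3 * e 4 * h' 1 - e 5 * f' 0 - e' 4 * h 0 + 3 * e' 4 *
      h 1 + e' 5 * f 0,
      e 0 * e' 4 + e 2 * e' 3 - e 3 * e' 2 - e 4 * e' 0 - e 5 * h' 0 + e' 5 * h 0],
      ![-3 * e 1 * f' 2 + 36 * e 4 * f' 5 + 3 * e' 1 * f 2 - 36 * e' 4 * f 5 + 2 * f 0 * h' 0 - 3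
      * f 0 * h' 1 - 2 * f' 0 * h 0 + 3 * f' 0 * h 1,
      e 0 * f' 2 + 4 * e 2 * f' 3 - 12 * e 3 * f' 4 - e' 0 * f 2 - 4 * e' 2 * f 3 + 12 * e' 3 * f
      4 - f 1 * h' 0 + 2 * f 1 * h' 1 + f' 1 * h 0 - 2 * f' 1 * h 1,
      4 * e 1 * f' 3 - 12 * e 3 * f' 5 - 4 * e' 1 * f 3 + 12 * e' 3 * f 5 + f 0 * f' 1 - f 1 * f'
      0 + f 2 * h' 0 - f 2 * h' 1 - f' 2 * h 0 + f' 2 * h 1,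
      3 * e 1 * f' 4 - 3 * e 2 * f' 5 - 3 * e' 1 * f 4 + 3 * e' 2 * f 5 + f 1 * f' 2 - f 2 * f' 1
      + f 3 * h' 1 - f' 3 * h 1,
      e 0 * f' 5 - e' 0 * f 5 + f 1 * f' 3 - f 3 * f' 1 - f 4 * h' 0 + 3 * f 4 * h' 1 + f' 4 * h 0
      - 3 * f' 4 * h 1,
      f 0 * f' 4 + f 2 * f' 3 - f 3 * f' 2 - f 4 * f' 0 + f 5 * h' 0 - f' 5 * h 0], ?_⟩
  ext i j
  rw [Ring.lie_def, Matrix.sub_apply, Matrix.mul_apply, Matrix.mul_apply, Fin.sum_univ_seven,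
    Fin.sum_univ_seven]
  fin_cases i <;> fin_cases j <;>
    (simp only [g2Matrix, Matrix.of_apply, Matrix.cons_val, Fin.zero_eta, Fin.mk_one,
      Fin.reduceFinMk]; ring)

/-- The simple complex Lie algebra of type `G₂`, as a Lie algebra of `7 × 7` matrices. -/
def g2 : LieSubalgebra ℂ (Matrix (Fin 7) (Fin 7) ℂ) where
  carrier := {M | ∃ h e f, M = g2Matrix h e f}
  zero_mem' := ⟨0, 0, 0, by ext i j; fin_cases i <;> fin_cases j <;> simp [g2Matrix]⟩
  add_mem' := by
    rintro _ _ ⟨h, e, f, rfl⟩ ⟨h', e', f', rfl⟩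
    exact ⟨_, _, _, g2Matrix_add h h' e f e' f'⟩
  smul_mem' := by
    rintro c _ ⟨h, e, f, rfl⟩
    exact ⟨_, _, _, g2Matrix_smul c h e f⟩
  lie_mem' := by
    rintro _ _ ⟨h, e, f, rfl⟩ ⟨h', e', f', rfl⟩
    exact g2Matrix_lie h h' e f e' f'

open Classical in
/-- The Killing form of `g2`, for matrices that lie in `g2` (and `0` for other matrices). -/
def killing (X Y : Matrix (Fin 7) (Fin 7) ℂ) : ℂ :=
  if h : X ∈ g2 ∧ Y ∈ g2 then killingForm ℂ g2 ⟨X, h.1⟩ ⟨Y, h.2⟩ else 0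

/-! ## Loops, and Laurent series in the spectral parameter -/

/-- Smooth complex functions on the circle `ℝ / 2πℤ`. -/
def Loop : Subalgebra ℂ (ℝ → ℂ) where
  carrier := {f | ContDiff ℝ ∞ f ∧ Function.Periodic f (2 * Real.pi)}
  mul_mem' := fun ha hb => ⟨ha.1.mul hb.1, ha.2.mul hb.2⟩
  add_mem' := fun ha hb => ⟨ha.1.add hb.1, ha.2.add hb.2⟩
  algebraMap_mem' := fun _ => ⟨contDiff_const, fun _ => rfl⟩

theorem deriv_mem_Loop (f : Loop) : deriv (f : ℝ → ℂ) ∈ Loop := by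
  refine ⟨?_, ?_⟩
  · exact ((contDiff_infty_iff_deriv (𝕜 := ℝ)).1 f.2.1).2
  · intro x
    have h : (fun y => (f : ℝ → ℂ) (y + 2 * Real.pi)) = f := funext f.2.2
    rw [← deriv_comp_add_const, h]

/-- The derivative `∂ₓ` of functions on the circle. -/
def Loop.d : Loop →ₗ[ℂ] Loop where
  toFun f := ⟨deriv (f : ℝ → ℂ), deriv_mem_Loop f⟩
  map_add' f g := by
    ext x
    exact deriv_add (f.2.1.differentiable (by simp) x) (g.2.1.differentiable (by simp) x)
  map_smul' c f := by
    ext x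
    exact deriv_const_smul c (f.2.1.differentiable (by simp) x)

/-- Loops of `7 × 7` matrices. -/
abbrev MatLoop : Type := Matrix (Fin 7) (Fin 7) Loop

instance : Ring MatLoop := inferInstance

/-- The value of a loop of matrices at a point. -/
def MatLoop.eval (M : MatLoop) (x : ℝ) : Matrix (Fin 7) (Fin 7) ℂ :=
  M.map fun f => (f : ℝ → ℂ) x

/-- Formal Laurent series in `λ⁻¹` (finitely many positive powers of `λ`) whose coefficients are
loops of matrices. The coefficient of `λ⁻ᵏ` in `X` is `X.coeff k`. -/
abbrev Series : Type := HahnSeries ℤ MatLoop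

instance : Ring Series := inferInstance

instance : AddGroup Series := inferInstance

/-- A loop of matrices as a constant series. -/
def const (M : MatLoop) : Series := HahnSeries.single 0 M

/-- The power `λⁿ` of the spectral parameter. -/
def lam (n : ℤ) : Series := HahnSeries.single (-n) 1

/-- The coefficientwise `x`-derivative of a series. -/
def dx (X : Series) : Series := X.map Loop.d.mapMatrix

/-- The residue: the coefficient of `λ⁻¹`. -/
def res (X : Series) : MatLoop := X.coeff 1

/-- Series whose coefficients are loops with values in `g2`. -/
def InG2 (X : Series) : Prop := ∀ (k : ℤ) (x : ℝ), (X.coeff k).eval x ∈ g2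

/-- The coefficient of `λ⁻ᵏ` in `⟨X, Y⟩ = ∫_{S¹} (X(x), Y(x)) dx`, where `(·, ·)` is the Killing
form, extended to series bilinearly over Laurent series. -/
def pairing (X Y : Series) (k : ℤ) : ℂ :=
  ∑ p ∈ Finset.antidiagonal X.isPWO_support Y.isPWO_support k,
    ∫ x in (0 : ℝ)..(2 * Real.pi), killing ((X.coeff p.1).eval x) ((Y.coeff p.2).eval x)

/-! ## The phase space and the Heisenberg subalgebra -/

/-- The element `A = F₆` of minimal weight. -/
def matA : MatLoop := g2Matrix 0 0 ![0, 0, 0, 0, 0, 1]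

/-- The element `B = E₁ + E₂`. -/
def matB : MatLoop := g2Matrix 0 ![1, 1, 0, 0, 0, 0] 0

/-- The tangent vector `h (2 H₁ + H₂) + f₁ F₁ + f₃ F₃ + f₄ F₄ + f₅ F₅ + f₆ F₆` to the symplectic
leaf, with `(h, f₁, f₃, f₄, f₅, f₆) = q`. -/
def tangent (q : Fin 6 → Loop) : MatLoop :=
  g2Matrix ![2 * q 0, q 0] 0 ![q 1, 0, q 2, q 3, q 4, q 5]

/-- The point `S = B + h (2 H₁ + H₂) + f₁ F₁ + f₃ F₃ + f₄ F₄ + f₅ F₅ + f₆ F₆` of the symplectic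
leaf, with `(h, f₁, f₃, f₄, f₅, f₆) = q`. -/
def point (q : Fin 6 → Loop) : MatLoop := matB + tangent q

/-- The series `S + λ A`. -/
def lax (q : Fin 6 → Loop) : Series := const (point q) + lam 1 * const matA

/-- The series `Λ = B + λ A`. -/
def Lam : Series := const matB + lam 1 * const matA

/-- `Λ^j` for `j ≡ ±1 mod 6`: by definition `Λ^(6n+1) = λⁿ (B + λ A)` and
`Λ^(6n-1) = λⁿ⁻¹ (B + λ A)⁵`. -/
def LamPow (j : ℤ) : Series :=
  if j % 6 = 1 then lam (j / 6) * Lam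
  else if j % 6 = 5 then lam (j / 6) * Lam ^ 5
  else 0

/-- The Heisenberg subalgebra: the isotropy subalgebra of `B + λ A`. -/
def InHeisenberg (X : Series) : Prop := InG2 X ∧ ⁅X, Lam⁆ = 0

/-- `C = ∑ c_j Λ⁻ʲ`, the sum over `j ≡ ±1 mod 6`, with constant complex coefficients that vanish for
all sufficiently negative `j`. In each power of `λ` the sum is finite. -/
def IsHeisenbergSum (c : ℤ → ℂ) (C : Series) : Prop :=
  (∃ N : ℤ, ∀ j < N, c j = 0) ∧
    ∀ k : ℤ, C.coeff k = ∑ᶠ j ∈ {j : ℤ | j % 6 = 1 ∨ j % 6 = 5}, c j • (LamPow (-j)).coeff k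

/-! ## Dressing -/

/-- The series has values in `g2` and strictly negative principal degree, where `λ` has degree `6`
and a matrix unit with entry at `(i, j)` has degree `j - i`. -/
def InG2Neg (U : Series) : Prop :=
  InG2 U ∧ (∀ k < 0, U.coeff k = 0) ∧ ∀ i j : Fin 7, i ≤ j → U.coeff 0 i j = 0

/-- `T` is the formal exponential of `U`. For `U` of strictly negative principal degree only finitely
many terms contribute to each power of `λ`. -/
def IsExp (U T : Series) : Prop :=
  ∀ k : ℤ, T.coeff k = ∑ᶠ n : ℕ, ((n.factorial : ℂ)⁻¹) • (U ^ n).coeff k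

/-- The operator `-∂ₓ + X`. -/
def diffOp (X : Series) (Y : Series) : Series := -dx Y + X * Y

/-- `T` is in the formal group of the loop algebra and
`T (-∂ₓ + S + λ A) T⁻¹ = -∂ₓ + (B + λ A) + H` with `H` in the Heisenberg subalgebra. -/
def IsDressing (q : Fin 6 → Loop) (T : Seriesˣ) : Prop :=
  (∃ U : Series, InG2Neg U ∧ IsExp U T) ∧
    ∃ H : Series, InHeisenberg H ∧
      ∀ Y : Series, (T : Series) * diffOp (lax q) ((T⁻¹ : Seriesˣ) * Y) = diffOp (Lam + H) Y

/-- `V_C = T⁻¹ C T`. -/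
def casimir (T : Seriesˣ) (C : Series) : Series := (T⁻¹ : Seriesˣ) * C * (T : Series)

/-- `J = T (S + λ A) T⁻¹ + Tₓ T⁻¹`. -/
def momentum (q : Fin 6 → Loop) (T : Seriesˣ) : Series :=
  (T : Series) * lax q * (T⁻¹ : Seriesˣ) + dx T * (T⁻¹ : Seriesˣ)

end

end G2Loop

open G2Loop

namespace G2Loop

noncomputable section

/-! ## Laurent series of `7 × 7` matrices over a commutative algebra -/

/-! The argument is Drinfeld–Sokolov dressing with respect to the filtration by principal degree, in
which order `d` means degree at most `-d`. Everything is developed over an arbitrary commutative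
`ℂ`-algebra `R`, because it is needed both for loops and for smooth one-parameter families of loops.

The algebraic input is `Λ ^ 7 = 24 λ Λ` (`LamOver_pow_seven`). Left and right multiplication by `Λ`
are commuting operators annihilated by `t ^ 7 - 24 λ t`, so their difference `ad Λ` is semisimple:
kernel and image are complementary, and `ad Λ` is inverted on its image by `adInv`, a polynomial in
`ad Λ`, `λ` and `λ⁻¹` (`mul_one_sub_mul_adInvOf`). Being such a polynomial, `adInv` preserves series
with values in `G₂`, commutes with every operator that commutes with `ad Λ` and `λ`, and raises the
order by exactly one.

Existence: adding `V` of order `n + 1` to `U` changes the potential `T L T⁻¹ + Tₓ T⁻¹` by `-[Λ, V]`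
modulo order `n + 1`. Hence `V` can be chosen to remove the image component of order `n`, and
completeness of the filtration gives the limit (`exists_gauge_comm_eq_zero`).

Uniqueness: the quotient `W = T' T⁻¹` of two dressings satisfies a linear equation whose projection
to the image of `ad Λ` forces that component of `W` to have infinite order. So `W` commutes with `Λ`
(`comm_eq_zero_of_intertwines`) and then with `C`, and `V_C` does not depend on `T`. The Casimir
equation is `[J, C] = 0` conjugated back by `T`.

Hamiltonian: the Killing form is four times the trace form (`killingForm_g2Equiv_symm`), so pairings
are integrals of traces. A change of dressing adds `tr(Wₓ W⁻¹ C)`, the `x`-derivative of `tr(log W ·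
C)`, which integrates to zero. For the differential, the dressing is carried out over the algebra of
families, where `∂ₜ` and `∂ₓ` commute. With `a = Tₜ T⁻¹` one gets `Jₜ = T Sₜ T⁻¹ + aₓ + [a, J]`;
tracing against `C` kills the commutator and integration kills `aₓ` (`deriv_trace_gauge_mul`).

Expansions: `λ` is central, so for each choice of sign all `V^(6n±1)` are shifts of one series, and
the range of `p` is read off from its order. -/

/-- Laurent series in `λ⁻¹` whose coefficients are `7 × 7` matrices over `R`. -/
abbrev LaurentMat (R : Type*) [Zero R] : Type _ := HahnSeries ℤ (Matrix (Fin 7) (Fin 7) R)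

instance (R : Type*) [CommRing R] : Ring (LaurentMat R) := HahnSeries.instRing

instance (R : Type*) [CommRing R] : Neg (LaurentMat R) := Ring.toNeg

instance (R : Type*) [CommRing R] : Sub (LaurentMat R) := Ring.toSub

instance (R : Type*) [CommRing R] [Algebra ℂ R] : Algebra ℂ (LaurentMat R) :=
  HahnSeries.instAlgebra

instance (R : Type*) [CommRing R] [Algebra ℂ R] : Module ℂ (LaurentMat R) := Algebra.toModule

theorem exists_coeff_eq_zero_of_lt {V : Type*} [Zero V] (X : HahnSeries ℤ V) :
    ∃ a : ℤ, ∀ k < a, X.coeff k = 0 :=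
  ⟨X.order, fun _ h => HahnSeries.coeff_eq_zero_of_lt_order h⟩

theorem exists_coeff_eq_zero_of_lt₂ {V W : Type*} [Zero V] [Zero W] (X : HahnSeries ℤ V)
    (Y : HahnSeries ℤ W) :
    ∃ a : ℤ, (∀ k < a, X.coeff k = 0) ∧ ∀ k < a, Y.coeff k = 0 :=
  ⟨min X.order Y.order,
    fun _ h => HahnSeries.coeff_eq_zero_of_lt_order (h.trans_le (min_le_left _ _)),
    fun _ h => HahnSeries.coeff_eq_zero_of_lt_order (h.trans_le (min_le_right _ _))⟩

/-- The antidiagonal depends on the supports of both series. The interval depends only on lower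
bounds, so sums for different pairs of series can be compared term by term. -/
theorem sum_antidiagonal_eq_sum_Icc {V W Z : Type*} [Zero V] [Zero W] [AddCommMonoid Z]
    (g : V → W → Z) (hg : ∀ v, g v 0 = 0) (hg' : ∀ w, g 0 w = 0)
    {X : HahnSeries ℤ V} {Y : HahnSeries ℤ W} {a b : ℤ}
    (hX : ∀ k < a, X.coeff k = 0) (hY : ∀ k < b, Y.coeff k = 0) (k : ℤ) :
    ∑ p ∈ Finset.antidiagonal X.isPWO_support Y.isPWO_support k, g (X.coeff p.1) (Y.coeff p.2) =
      ∑ i ∈ Finset.Icc a (k - b), g (X.coeff i) (Y.coeff (k - i)) := by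
  refine Finset.sum_of_injOn Prod.fst ?_ ?_ ?_ ?_
  · rintro ⟨p, q⟩ hp ⟨p', q'⟩ hp' h
    simp only [Finset.mem_coe, Finset.mem_antidiagonal] at hp hp' h
    ext <;> simp only <;> omega
  · rintro ⟨p, q⟩ hp
    simp only [Finset.mem_coe, Finset.mem_antidiagonal, HahnSeries.mem_support] at hp
    have h1 : ¬ p < a := fun h => hp.1 (hX p h)
    have h2 : ¬ q < b := fun h => hp.2.1 (hY q h)
    simp only [Finset.coe_Icc, Set.mem_Icc]
    omega
  · intro i _ hi
    by_cases h1 : X.coeff i = 0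
    · rw [h1, hg']
    by_cases h2 : Y.coeff (k - i) = 0
    · rw [h2, hg]
    exact (hi ⟨(i, k - i), by simp [Finset.mem_antidiagonal, h1, h2], rfl⟩).elim
  · rintro ⟨p, q⟩ hp
    simp only [Finset.mem_antidiagonal] at hp
    have : q = k - p := by omega
    simp [this]

theorem coeff_mul_eq_sum_Icc {V : Type*} [NonUnitalNonAssocSemiring V] {X Y : HahnSeries ℤ V}
    {a b : ℤ} (hX : ∀ k < a, X.coeff k = 0) (hY : ∀ k < b, Y.coeff k = 0) (k : ℤ) :
    (X * Y).coeff k = ∑ i ∈ Finset.Icc a (k - b), X.coeff i * Y.coeff (k - i) := by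
  rw [HahnSeries.coeff_mul]
  exact sum_antidiagonal_eq_sum_Icc (· * ·) mul_zero zero_mul hX hY k

/-! ### The filtration by principal degree: multiplicative, separated and complete. -/

section Filtration

variable {R : Type*} [CommRing R] [Algebra ℂ R]

/-- The series of principal degree at most `-d`, where `λ` has degree `6` and a matrix unit with
entry at `(i, j)` has degree `j - i`. -/
def filt (R : Type*) [CommRing R] [Algebra ℂ R] (d : ℤ) : Submodule ℂ (LaurentMat R) where
  carrier := {X | ∀ (k : ℤ) (i j : Fin 7), 6 * k + (i : ℕ) - (j : ℕ) < d → X.coeff k i j = 0}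
  zero_mem' := fun _ _ _ _ => rfl
  add_mem' := fun hX hY k i j h => by
    rw [HahnSeries.coeff_add, Matrix.add_apply, hX k i j h, hY k i j h, add_zero]
  smul_mem' := fun c X hX k i j h => by
    rw [HahnSeries.coeff_smul, Matrix.smul_apply, hX k i j h, smul_zero]

theorem filt_anti {d e : ℤ} (h : d ≤ e) : filt R e ≤ filt R d :=
  fun _ hX k i j hk => hX k i j (hk.trans_le h)

theorem mul_mem_filt {X Y : LaurentMat R} {d e : ℤ} (hX : X ∈ filt R d) (hY : Y ∈ filt R e) :
    X * Y ∈ filt R (d + e) := by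
  intro k i j hk
  obtain ⟨a, ha, hb⟩ := exists_coeff_eq_zero_of_lt₂ X Y
  rw [coeff_mul_eq_sum_Icc ha hb, Matrix.sum_apply]
  refine Finset.sum_eq_zero fun m _ => ?_
  rw [Matrix.mul_apply]
  refine Finset.sum_eq_zero fun r _ => ?_
  by_cases h : 6 * m + (i : ℕ) - (r : ℕ) < d
  · rw [hX m i r h, zero_mul]
  · rw [hY (k - m) r j (by omega), mul_zero]

theorem mul_mem_filt' {X Y : LaurentMat R} {d e f : ℤ} (hX : X ∈ filt R d) (hY : Y ∈ filt R e)
    (h : f ≤ d + e) : X * Y ∈ filt R f :=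
  filt_anti h (mul_mem_filt hX hY)

theorem one_mem_filt : (1 : LaurentMat R) ∈ filt R 0 := by
  intro k i j hk
  rw [HahnSeries.coeff_one]
  split_ifs with h
  · refine Matrix.one_apply_ne fun hij => ?_
    subst h hij
    omega
  · rfl

theorem pow_mem_filt {X : LaurentMat R} {d : ℤ} (hX : X ∈ filt R d) (n : ℕ) :
    X ^ n ∈ filt R (n * d) := by
  induction n with
  | zero => simpa using one_mem_filt
  | succ n ih =>
    rw [pow_succ]
    exact mul_mem_filt' ih hX (by push_cast; linarith)

/-- Matrix units have degree at most `6` in absolute value, so order above `6 * k + 6` leaves no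
entry in the coefficient `k`. This turns congruences modulo high order into equalities of
coefficients. -/
theorem coeff_eq_zero_of_mem_filt {X : LaurentMat R} {d : ℤ} (hX : X ∈ filt R d) {k : ℤ}
    (hk : 6 * k + 6 < d) : X.coeff k = 0 := by
  ext i j
  exact hX k i j (by have := i.2; have := j.2; omega)

theorem eq_zero_of_forall_mem_filt {X : LaurentMat R} (h : ∀ n : ℕ, X ∈ filt R n) : X = 0 := by
  ext1
  funext k
  exact coeff_eq_zero_of_mem_filt (h (6 * k + 7).toNat) (by omega)

theorem exists_mem_filt (X : LaurentMat R) : ∃ d : ℤ, X ∈ filt R d := by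
  obtain ⟨a, ha⟩ := exists_coeff_eq_zero_of_lt X
  refine ⟨6 * a - 6, fun k i j hk => ?_⟩
  rw [ha k (by have := i.2; have := j.2; omega)]
  rfl

theorem coeff_sum {V ι : Type*} [AddCommMonoid V] (s : Finset ι) (f : ι → HahnSeries ℤ V) (k : ℤ) :
    (∑ i ∈ s, f i).coeff k = ∑ i ∈ s, (f i).coeff k := by
  classical
  induction s using Finset.induction_on with
  | empty => rfl
  | insert a s ha ih => rw [Finset.sum_insert ha, Finset.sum_insert ha, HahnSeries.coeff_add, ih]

/-- The filtration is complete: a series of elements of increasing filtration converges. -/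
theorem exists_sum_filt (f : ℕ → LaurentMat R) (hf : ∀ n : ℕ, f n ∈ filt R n) :
    ∃ X : LaurentMat R, ∀ N : ℕ, X - ∑ n ∈ Finset.range N, f n ∈ filt R N := by
  -- Only the terms with `n < 6 * k + 7` can reach the coefficient `k`, so the infinite sum is
  -- finite in each coefficient.
  let g : ℤ → Matrix (Fin 7) (Fin 7) R := fun k =>
    ∑ n ∈ Finset.range (6 * k + 7).toNat, (f n).coeff k
  have hg : BddBelow (Function.support g) := by
    refine ⟨-1, fun k hk => ?_⟩
    by_contra h
    refine hk ?_
    simp only [g]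
    rw [Int.toNat_of_nonpos (by omega), Finset.sum_range_zero]
  refine ⟨HahnSeries.ofSuppBddBelow g hg, fun N k i j hk => ?_⟩
  have hle (a b : ℕ) (hab : a ≤ b) (ha : 6 * k + (i : ℕ) - (j : ℕ) < a) :
      ∑ n ∈ Finset.range b, (f n).coeff k i j = ∑ n ∈ Finset.range a, (f n).coeff k i j := by
    refine (Finset.sum_subset (Finset.range_mono hab) fun n _ hn => ?_).symm
    rw [Finset.mem_range] at hn
    exact hf n k i j (by omega)
  rw [HahnSeries.coeff_sub, coeff_sum, HahnSeries.coeff_ofSuppBddBelow, Matrix.sub_apply,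
    Matrix.sum_apply, sub_eq_zero]
  simp only [g, Matrix.sum_apply]
  have := i.2
  have := j.2
  rcases le_total N (6 * k + 7).toNat with h | h
  · exact hle _ _ h hk
  · exact (hle _ _ h (by omega)).symm

/-- Two series that agree with a sequence to increasing order are equal. -/
theorem eq_of_forall_sub_mem_filt {X Y : LaurentMat R} (h : ∀ n : ℕ, X - Y ∈ filt R n) : X = Y :=
  sub_eq_zero.1 (eq_zero_of_forall_mem_filt h)

theorem eq_of_approx {X Y : LaurentMat R} (d : ℤ) (h : ∀ n : ℕ, X - Y ∈ filt R (n + d)) : X = Y :=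
  eq_of_forall_sub_mem_filt fun n => filt_anti (by omega) (h (n - d).toNat)

/-! ### The unipotent group -/

theorem inv_mem_filt {T : (LaurentMat R)ˣ} (hT : (T : LaurentMat R) - 1 ∈ filt R 1) :
    ((T⁻¹ : (LaurentMat R)ˣ) : LaurentMat R) ∈ filt R 0 := by
  obtain ⟨d, hd⟩ := exists_mem_filt ((T⁻¹ : (LaurentMat R)ˣ) : LaurentMat R)
  -- Bootstrap: `T⁻¹ = 1 - (T - 1) T⁻¹` gains one order at each use, until the order `0` of `1` is
  -- reached.
  have key (n : ℕ) : ((T⁻¹ : (LaurentMat R)ˣ) : LaurentMat R) ∈ filt R (min 0 (d + n)) := by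
    induction n with
    | zero => exact filt_anti (by omega) hd
    | succ n ih =>
      have h : ((T⁻¹ : (LaurentMat R)ˣ) : LaurentMat R) =
          1 - ((T : LaurentMat R) - 1) * ((T⁻¹ : (LaurentMat R)ˣ) : LaurentMat R) := by
        rw [sub_mul, Units.mul_inv, one_mul]; abel
      rw [h]
      exact sub_mem (filt_anti (by omega) one_mem_filt) (mul_mem_filt' hT ih (by push_cast; omega))
  exact filt_anti (by omega) (key (-d).toNat)

theorem inv_sub_one_mem_filt {T : (LaurentMat R)ˣ} (hT : (T : LaurentMat R) - 1 ∈ filt R 1) :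
    ((T⁻¹ : (LaurentMat R)ˣ) : LaurentMat R) - 1 ∈ filt R 1 := by
  have h : ((T⁻¹ : (LaurentMat R)ˣ) : LaurentMat R) - 1 =
      -(((T : LaurentMat R) - 1) * ((T⁻¹ : (LaurentMat R)ˣ) : LaurentMat R)) := by
    rw [sub_mul, Units.mul_inv, one_mul]; abel
  rw [h]
  exact neg_mem (mul_mem_filt' hT (inv_mem_filt hT) (by omega))

theorem mem_filt_of_sub_one {T : LaurentMat R} (hT : T - 1 ∈ filt R 1) : T ∈ filt R 0 := by
  have := add_mem (filt_anti (by omega) hT) (one_mem_filt (R := R))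
  simpa using this

end Filtration

/-! ## Exponentials of series of negative degree -/

section Ring

variable {A : Type*} [Ring A] [Algebra ℂ A]

/-- The linear map `X ↦ u X - X u`. -/
def comm (u : A) : Module.End ℂ A := LinearMap.mulLeft ℂ u - LinearMap.mulRight ℂ u

@[simp]
theorem comm_apply (u X : A) : comm u X = u * X - X * u := rfl

/-- The truncated exponential series. -/
def expTrunc (u : A) (N : ℕ) : A := ∑ n ∈ Finset.range N, (n.factorial : ℂ)⁻¹ • u ^ n

/-- `ad u` is the sum of left multiplication by `u` and right multiplication by `-u`. These commute,
so the binomial theorem applies, and dividing by `n!` gives the degree `n` part of a product of two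
exponentials. -/
theorem comm_pow_apply (u D : A) (n : ℕ) :
    (n.factorial : ℂ)⁻¹ • (comm u ^ n) D = ∑ p ∈ Finset.HasAntidiagonal.antidiagonal n,
      ((p.1.factorial : ℂ)⁻¹ • u ^ p.1) * D * ((p.2.factorial : ℂ)⁻¹ • (-u) ^ p.2) := by
  have h : comm u = LinearMap.mulLeft ℂ u + LinearMap.mulRight ℂ (-u) := by
    ext X; simp [sub_eq_add_neg]
  rw [h, (LinearMap.commute_mulLeft_right (R := ℂ) u (-u)).add_pow', LinearMap.sum_apply,
    Finset.smul_sum]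
  refine Finset.sum_congr rfl fun p hp => ?_
  rw [Finset.HasAntidiagonal.mem_antidiagonal] at hp
  subst hp
  rw [LinearMap.smul_apply, Module.End.mul_apply, LinearMap.pow_mulLeft, LinearMap.pow_mulRight,
    LinearMap.mulRight_apply, LinearMap.mulLeft_apply, ← Nat.cast_smul_eq_nsmul ℂ, smul_smul,
    smul_mul_assoc, smul_mul_assoc, mul_smul_comm, smul_smul, mul_assoc]
  congr 1
  have h1 := Nat.add_choose_mul_factorial_mul_factorial p.1 p.2
  rw [← Nat.choose_symm_add] at h1
  have h2 : ((p.1 + p.2).choose p.1 : ℂ) * p.1.factorial * p.2.factorial =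
      (p.1 + p.2).factorial := by exact_mod_cast h1
  have h3 : (p.1.factorial : ℂ) ≠ 0 := by exact_mod_cast p.1.factorial_ne_zero
  have h4 : (p.2.factorial : ℂ) ≠ 0 := by exact_mod_cast p.2.factorial_ne_zero
  have h5 : ((p.1 + p.2).factorial : ℂ) ≠ 0 := by exact_mod_cast (p.1 + p.2).factorial_ne_zero
  field_simp
  linear_combination h2

/-- The terms of total degree below `N` reassemble to the truncated `exp (ad u)`, and the hypothesis
on `P` absorbs the others. The algebra is arbitrary because the identity is used twice: for series,
and for operators on series with `D` a derivation. -/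
theorem expTrunc_mul_mul_expTrunc_sub_mem (u D : A) (N : ℕ) (P : Submodule ℂ A)
    (hP : ∀ a b, N ≤ a + b → u ^ a * D * (-u) ^ b ∈ P) :
    expTrunc u N * D * expTrunc (-u) N -
      ∑ n ∈ Finset.range N, (n.factorial : ℂ)⁻¹ • (comm u ^ n) D ∈ P := by
  set f : ℕ × ℕ → A := fun p =>
    ((p.1.factorial : ℂ)⁻¹ • u ^ p.1) * D * ((p.2.factorial : ℂ)⁻¹ • (-u) ^ p.2) with hf
  have h1 : expTrunc u N * D * expTrunc (-u) N =
      ∑ p ∈ Finset.range N ×ˢ Finset.range N, f p := by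
    rw [expTrunc, expTrunc, Finset.sum_mul, Finset.sum_mul_sum, Finset.sum_product]
  have h2 : ∑ n ∈ Finset.range N, (n.factorial : ℂ)⁻¹ • (comm u ^ n) D =
      ∑ p ∈ (Finset.range N ×ˢ Finset.range N).filter (fun p => p.1 + p.2 < N), f p := by
    rw [← Finset.sum_fiberwise_of_maps_to (t := Finset.range N) (g := fun p : ℕ × ℕ => p.1 + p.2)
      (by simp)]
    refine Finset.sum_congr rfl fun n hn => ?_
    rw [comm_pow_apply]
    refine Finset.sum_congr ?_ fun _ _ => rfl
    ext p
    simp only [Finset.mem_range, Finset.HasAntidiagonal.mem_antidiagonal, Finset.mem_filter,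
      Finset.mem_product] at hn ⊢
    omega
  rw [h1, h2, ← Finset.sum_filter_add_sum_filter_not _ (fun p : ℕ × ℕ => p.1 + p.2 < N),
    add_sub_cancel_left]
  refine sum_mem fun p hp => ?_
  simp only [Finset.mem_filter, not_lt] at hp
  simp only [hf, smul_mul_assoc, mul_smul_comm]
  exact P.smul_mem _ (P.smul_mem _ (hP _ _ hp.2))

end Ring

section Exp

variable {R : Type*} [CommRing R] [Algebra ℂ R]

/-- `T` is the limit of the exponential series of `U` for the degree filtration. -/
def IsExpLim (U T : LaurentMat R) : Prop := ∀ N : ℕ, T - expTrunc U N ∈ filt R N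

theorem pow_mem_filt_one {U : LaurentMat R} (hU : U ∈ filt R 1) (n : ℕ) : U ^ n ∈ filt R n := by
  simpa using pow_mem_filt hU n

theorem exists_isExpLim {U : LaurentMat R} (hU : U ∈ filt R 1) : ∃ T, IsExpLim U T :=
  exists_sum_filt (fun n => (n.factorial : ℂ)⁻¹ • U ^ n)
    fun n => Submodule.smul_mem _ _ (pow_mem_filt_one hU n)

theorem IsExpLim.sub_one_mem {U T : LaurentMat R} (h : IsExpLim U T) : T - 1 ∈ filt R 1 := by
  simpa [expTrunc] using h 1

theorem IsExpLim.unique {U T T' : LaurentMat R} (h : IsExpLim U T) (h' : IsExpLim U T') : T = T' :=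
  eq_of_forall_sub_mem_filt fun n => by simpa using sub_mem (h n) (h' n)

theorem IsExpLim.mem_filt {U T : LaurentMat R} (h : IsExpLim U T) : T ∈ filt R 0 :=
  mem_filt_of_sub_one h.sub_one_mem

theorem expTrunc_mem_filt {U : LaurentMat R} (hU : U ∈ filt R 1) (N : ℕ) :
    expTrunc U N ∈ filt R 0 :=
  sum_mem fun n _ => Submodule.smul_mem _ _ (filt_anti (by omega) (pow_mem_filt_one hU n))

theorem mul_mul_sub_mul_mul_mem_filt {T T₀ X Y Y₀ : LaurentMat R} {d n : ℤ}
    (hT : T - T₀ ∈ filt R n) (hY : Y - Y₀ ∈ filt R n) (hX : X ∈ filt R d) (hT₀ : T₀ ∈ filt R 0)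
    (hY' : Y ∈ filt R 0) : T * X * Y - T₀ * X * Y₀ ∈ filt R (n + d) := by
  have h : T * X * Y - T₀ * X * Y₀ = (T - T₀) * X * Y + T₀ * X * (Y - Y₀) := by noncomm_ring
  rw [h]
  exact add_mem (mul_mem_filt' (mul_mem_filt hT hX) hY' (by omega))
    (mul_mem_filt' (mul_mem_filt hT₀ hX) hY (by omega))

/-- Conjugation by `exp U` is `exp (ad U)`. -/
theorem IsExpLim.conj_sub_mem {U T T' X : LaurentMat R} {d : ℤ} (hU : U ∈ filt R 1)
    (hT : IsExpLim U T) (hT' : IsExpLim (-U) T') (hX : X ∈ filt R d) (N : ℕ) :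
    T * X * T' - ∑ n ∈ Finset.range N, (n.factorial : ℂ)⁻¹ • (comm U ^ n) X ∈ filt R (N + d) := by
  have h1 := mul_mul_sub_mul_mul_mem_filt (hT N) (hT' N) hX (expTrunc_mem_filt hU N) hT'.mem_filt
  have h2 := expTrunc_mul_mul_expTrunc_sub_mem U X N (filt R (N + d)) fun a b hab =>
    mul_mem_filt' (mul_mem_filt (pow_mem_filt_one hU a) hX)
      (pow_mem_filt_one (neg_mem hU) b) (by omega)
  simpa using add_mem h1 h2

theorem IsExpLim.mul_eq_one {U T T' : LaurentMat R} (hU : U ∈ filt R 1)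
    (hT : IsExpLim U T) (hT' : IsExpLim (-U) T') : T * T' = 1 := by
  refine eq_of_forall_sub_mem_filt fun N => filt_anti (by omega) (e := ((N + 1 : ℕ) : ℤ) + 0) ?_
  have h := hT.conj_sub_mem hU hT' one_mem_filt (N + 1)
  -- Conjugation of `1`: every commutator with `1` vanishes, so only the term `n = 0` survives.
  rw [Finset.sum_range_succ', Finset.sum_eq_zero fun n _ => ?_] at h
  · simpa using h
  · rw [pow_succ, Module.End.mul_apply]
    simp

/-- The exponential as a unit. -/
theorem exists_unit_isExpLim {U : LaurentMat R} (hU : U ∈ filt R 1) :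
    ∃ T : (LaurentMat R)ˣ, IsExpLim U T ∧
      IsExpLim (-U) ((T⁻¹ : (LaurentMat R)ˣ) : LaurentMat R) := by
  obtain ⟨T, hT⟩ := exists_isExpLim hU
  obtain ⟨T', hT'⟩ := exists_isExpLim (neg_mem hU)
  exact ⟨⟨T, T', hT.mul_eq_one hU hT', hT'.mul_eq_one (neg_mem hU) (by rwa [neg_neg])⟩, hT, hT'⟩

theorem IsExpLim.inv {U : LaurentMat R} {T : (LaurentMat R)ˣ} (hU : U ∈ filt R 1)
    (hT : IsExpLim U T) : IsExpLim (-U) ((T⁻¹ : (LaurentMat R)ˣ) : LaurentMat R) := by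
  obtain ⟨T₁, h1, h2⟩ := exists_unit_isExpLim hU
  obtain rfl : T = T₁ := Units.ext (hT.unique h1)
  exact h2

/-- Perturbation of the exponential. -/
theorem IsExpLim.sub_sub_mem {U V T T' : LaurentMat R} {n : ℕ} (hU : U ∈ filt R 1)
    (hV : V ∈ filt R (n + 1)) (hT : IsExpLim U T) (hT' : IsExpLim (U + V) T') :
    T' - T - V ∈ filt R (n + 2) := by
  have hUV : U + V ∈ filt R 1 := add_mem hU (filt_anti (by omega) hV)
  -- The powers of exponent at least two change only in order `n + 2`, while the linear term changes
  -- by `V` exactly.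
  have key (k : ℕ) : (U + V) ^ (k + 1) - U ^ (k + 1) ∈ filt R (n + 1 + k) := by
    induction k with
    | zero => simpa using hV
    | succ k ih =>
      have h : (U + V) ^ (k + 1 + 1) - U ^ (k + 1 + 1) =
          ((U + V) ^ (k + 1) - U ^ (k + 1)) * (U + V) + U ^ (k + 1) * V := by
        rw [pow_succ (U + V) (k + 1), pow_succ U (k + 1), sub_mul, mul_add, mul_add]; abel
      rw [h]
      exact add_mem (mul_mem_filt' ih hUV (by push_cast; omega))
        (mul_mem_filt' (pow_mem_filt_one hU _) hV (by push_cast; omega))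
  have h1 := hT (n + 2)
  have h2 := hT' (n + 2)
  have h3 : expTrunc (U + V) (n + 2) - expTrunc U (n + 2) - V ∈ filt R (n + 2) := by
    rw [expTrunc, expTrunc, ← Finset.sum_sub_distrib]
    have hs (k : ℕ) (X Y : LaurentMat R) : (k.factorial : ℂ)⁻¹ • X - (k.factorial : ℂ)⁻¹ • Y =
        (k.factorial : ℂ)⁻¹ • (X - Y) := (smul_sub _ _ _).symm
    simp only [hs]
    rw [Finset.sum_range_succ', Finset.sum_range_succ']
    have h : ∑ k ∈ Finset.range n, ((k + 1 + 1).factorial : ℂ)⁻¹ •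
        ((U + V) ^ (k + 1 + 1) - U ^ (k + 1 + 1)) ∈ filt R (n + 2) :=
      sum_mem fun k _ => Submodule.smul_mem _ _ (filt_anti (by push_cast; omega) (key (k + 1)))
    simpa using h
  have h4 : T' - T - V = (T' - expTrunc (U + V) (n + 2)) - (T - expTrunc U (n + 2)) +
      (expTrunc (U + V) (n + 2) - expTrunc U (n + 2) - V) := by abel
  rw [h4]
  push_cast at h1 h2
  exact add_mem (sub_mem h2 h1) h3

end Exp

/-! ## Matrices of type `G₂` over a commutative algebra -/

section LieBracket

variable {R : Type*} [CommRing R]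

/-- The Cartan coordinates of the bracket of two elements of `G₂`. -/
def bracketH (e f e' f' : Fin 6 → R) : Fin 2 → R :=
  ![e 0 * f' 0 - 3 * e 2 * f' 2 + 12 * e 3 * f' 3 - 36 * e 4 * f' 4 + 72 * e 5 * f' 5 - e' 0 *
    f 0 + 3 * e' 2 * f 2 - 12 * e' 3 * f 3 + 36 * e' 4 * f 4 - 72 * e' 5 * f 5,
    e 1 * f' 1 - e 2 * f' 2 + 8 * e 3 * f' 3 - 36 * e 4 * f' 4 + 36 * e 5 * f' 5 - e' 1 * f 1 +
    e' 2 * f 2 - 8 * e' 3 * f 3 + 36 * e' 4 * f 4 - 36 * e' 5 * f 5]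

/-- The coordinates of the bracket of two elements of `G₂` along the positive root vectors. -/
def bracketE (h h' : Fin 2 → R) (e f e' f' : Fin 6 → R) : Fin 6 → R :=
  ![-2 * e 0 * h' 0 + 3 * e 0 * h' 1 + 3 * e 2 * f' 1 - 36 * e 5 * f' 4 + 2 * e' 0 * h 0 - 3 *
    e' 0 * h 1 - 3 * e' 2 * f 1 + 36 * e' 5 * f 4,
    e 1 * h' 0 - 2 * e 1 * h' 1 - e 2 * f' 0 - 4 * e 3 * f' 2 + 12 * e 4 * f' 3 - e' 1 * h 0 + 2
    * e' 1 * h 1 + e' 2 * f 0 + 4 * e' 3 * f 2 - 12 * e' 4 * f 3,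
    e 0 * e' 1 - e 1 * e' 0 - e 2 * h' 0 + e 2 * h' 1 - 4 * e 3 * f' 1 + 12 * e 5 * f' 3 + e' 2
    * h 0 - e' 2 * h 1 + 4 * e' 3 * f 1 - 12 * e' 5 * f 3,
    e 1 * e' 2 - e 2 * e' 1 - e 3 * h' 1 - 3 * e 4 * f' 1 + 3 * e 5 * f' 2 + e' 3 * h 1 + 3 * e'
    4 * f 1 - 3 * e' 5 * f 2,
    e 1 * e' 3 - e 3 * e' 1 + e 4 * h' 0 - 3 * e 4 * h' 1 - e 5 * f' 0 - e' 4 * h 0 + 3 * e' 4 *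
    h 1 + e' 5 * f 0,
    e 0 * e' 4 + e 2 * e' 3 - e 3 * e' 2 - e 4 * e' 0 - e 5 * h' 0 + e' 5 * h 0]

/-- The coordinates of the bracket of two elements of `G₂` along the negative root vectors. -/
def bracketF (h h' : Fin 2 → R) (e f e' f' : Fin 6 → R) : Fin 6 → R :=
  ![-3 * e 1 * f' 2 + 36 * e 4 * f' 5 + 3 * e' 1 * f 2 - 36 * e' 4 * f 5 + 2 * f 0 * h' 0 - 3
    * f 0 * h' 1 - 2 * f' 0 * h 0 + 3 * f' 0 * h 1,
    e 0 * f' 2 + 4 * e 2 * f' 3 - 12 * e 3 * f' 4 - e' 0 * f 2 - 4 * e' 2 * f 3 + 12 * e' 3 * f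
    4 - f 1 * h' 0 + 2 * f 1 * h' 1 + f' 1 * h 0 - 2 * f' 1 * h 1,
    4 * e 1 * f' 3 - 12 * e 3 * f' 5 - 4 * e' 1 * f 3 + 12 * e' 3 * f 5 + f 0 * f' 1 - f 1 * f'
    0 + f 2 * h' 0 - f 2 * h' 1 - f' 2 * h 0 + f' 2 * h 1,
    3 * e 1 * f' 4 - 3 * e 2 * f' 5 - 3 * e' 1 * f 4 + 3 * e' 2 * f 5 + f 1 * f' 2 - f 2 * f' 1
    + f 3 * h' 1 - f' 3 * h 1,
    e 0 * f' 5 - e' 0 * f 5 + f 1 * f' 3 - f 3 * f' 1 - f 4 * h' 0 + 3 * f 4 * h' 1 + f' 4 * h 0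
    - 3 * f' 4 * h 1,
    f 0 * f' 4 + f 2 * f' 3 - f 3 * f' 2 - f 4 * f' 0 + f 5 * h' 0 - f' 5 * h 0]

theorem g2Matrix_mul_sub_mul (h h' : Fin 2 → R) (e f e' f' : Fin 6 → R) :
    g2Matrix h e f * g2Matrix h' e' f' - g2Matrix h' e' f' * g2Matrix h e f =
      g2Matrix (bracketH e f e' f') (bracketE h h' e f e' f') (bracketF h h' e f e' f') := by
  ext i j
  rw [Matrix.sub_apply, Matrix.mul_apply, Matrix.mul_apply, Fin.sum_univ_seven,
    Fin.sum_univ_seven]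
  fin_cases i <;> fin_cases j <;>
    (simp only [g2Matrix, bracketH, bracketE, bracketF, Matrix.of_apply, Matrix.cons_val,
      Fin.zero_eta, Fin.mk_one, Fin.reduceFinMk]; ring)

theorem map_g2Matrix {R' : Type*} [CommRing R'] (φ : R →+* R') (h : Fin 2 → R) (e f : Fin 6 → R) :
    φ.mapMatrix (g2Matrix h e f) = g2Matrix (φ ∘ h) (φ ∘ e) (φ ∘ f) := by
  have h2 : φ 2 = 2 := map_ofNat φ 2
  have h4 : φ 4 = 4 := map_ofNat φ 4
  have h6 : φ 6 = 6 := map_ofNat φ 6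
  ext i j
  fin_cases i <;> fin_cases j <;> simp [g2Matrix, h2, h4, h6]

/-- The entries are integral linear combinations of the coordinates, so linearity suffices. This
covers derivations and scalar multiplications, which are not ring homomorphisms. -/
theorem linearMap_mapMatrix_g2Matrix [Algebra ℂ R] {R' : Type*} [CommRing R'] [Algebra ℂ R']
    (φ : R →ₗ[ℂ] R') (h : Fin 2 → R) (e f : Fin 6 → R) :
    φ.mapMatrix (g2Matrix h e f) = g2Matrix (φ ∘ h) (φ ∘ e) (φ ∘ f) := by
  have hmul (n : ℕ) (a : R) : φ (n * a) = n * φ a := by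
    rw [← nsmul_eq_mul, map_nsmul, nsmul_eq_mul]
  have h2 (a : R) : φ (2 * a) = 2 * φ a := by exact_mod_cast hmul 2 a
  have h4 (a : R) : φ (4 * a) = 4 * φ a := by exact_mod_cast hmul 4 a
  have h6 (a : R) : φ (6 * a) = 6 * φ a := by exact_mod_cast hmul 6 a
  ext i j
  fin_cases i <;> fin_cases j <;> simp [g2Matrix, h2, h4, h6]

/-- The matrices over `R` of type `G₂`. -/
def g2Mat (R : Type*) [CommRing R] [Algebra ℂ R] : Submodule ℂ (Matrix (Fin 7) (Fin 7) R) where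
  carrier := {M | ∃ h e f, M = g2Matrix h e f}
  zero_mem' := ⟨0, 0, 0, by ext i j; fin_cases i <;> fin_cases j <;> simp [g2Matrix]⟩
  add_mem' := by
    rintro _ _ ⟨h, e, f, rfl⟩ ⟨h', e', f', rfl⟩
    refine ⟨h + h', e + e', f + f', ?_⟩
    ext i j
    fin_cases i <;> fin_cases j <;> simp [g2Matrix] <;> ring
  smul_mem' := by
    rintro c _ ⟨h, e, f, rfl⟩
    exact ⟨_, _, _, linearMap_mapMatrix_g2Matrix (c • LinearMap.id (R := ℂ) (M := R)) h e f⟩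

theorem g2Mat_mul_sub_mul [Algebra ℂ R] {M N : Matrix (Fin 7) (Fin 7) R} (hM : M ∈ g2Mat R)
    (hN : N ∈ g2Mat R) : M * N - N * M ∈ g2Mat R := by
  obtain ⟨h, e, f, rfl⟩ := hM
  obtain ⟨h', e', f', rfl⟩ := hN
  exact ⟨_, _, _, g2Matrix_mul_sub_mul h h' e f e' f'⟩

end LieBracket

/-! ## Series with values in `G₂` -/

section Series

variable {R : Type*} [CommRing R] [Algebra ℂ R]

/-- The series with coefficients in `g2Mat R`. -/
def g2Series (R : Type*) [CommRing R] [Algebra ℂ R] : Submodule ℂ (LaurentMat R) where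
  carrier := {X | ∀ k, X.coeff k ∈ g2Mat R}
  zero_mem' := fun _ => zero_mem _
  add_mem' := fun hX hY k => add_mem (hX k) (hY k)
  smul_mem' := fun c _ hX k => (g2Mat R).smul_mem c (hX k)

/-- Reindexing by the second factor lets the coefficients of `X * Y` and `Y * X` be matched term by
term, as commutators and cyclicity of the trace require. -/
theorem coeff_mul_eq_sum_Icc' {V : Type*} [NonUnitalNonAssocSemiring V] {X Y : HahnSeries ℤ V}
    {a b : ℤ} (hX : ∀ k < a, X.coeff k = 0) (hY : ∀ k < b, Y.coeff k = 0) (k : ℤ) :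
    (X * Y).coeff k = ∑ i ∈ Finset.Icc b (k - a), X.coeff (k - i) * Y.coeff i := by
  rw [coeff_mul_eq_sum_Icc hX hY]
  refine Finset.sum_nbij' (k - ·) (k - ·) ?_ ?_ ?_ ?_ ?_ <;> intro i hi <;>
    simp only [Finset.mem_Icc] at hi ⊢ <;> first | omega | simp

theorem comm_mem_g2Series {X Y : LaurentMat R} (hX : X ∈ g2Series R) (hY : Y ∈ g2Series R) :
    comm X Y ∈ g2Series R := by
  intro k
  obtain ⟨a, ha, hb⟩ := exists_coeff_eq_zero_of_lt₂ X Y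
  rw [comm_apply, HahnSeries.coeff_sub, coeff_mul_eq_sum_Icc ha hb, coeff_mul_eq_sum_Icc' hb ha,
    ← Finset.sum_sub_distrib]
  exact sum_mem fun i _ => g2Mat_mul_sub_mul (hX i) (hY (k - i))

theorem comm_pow_mem_g2Series {X Y : LaurentMat R} (hX : X ∈ g2Series R) (hY : Y ∈ g2Series R)
    (n : ℕ) : (comm X ^ n) Y ∈ g2Series R := by
  induction n with
  | zero => simpa using hY
  | succ n ih =>
    rw [pow_succ', Module.End.mul_apply]
    exact comm_mem_g2Series hX ih

/-- The series with values in `G₂` are closed for the filtration: each coefficient coincides with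
that of a good enough approximant. -/
theorem mem_g2Series_of_approx {X : LaurentMat R} (d : ℤ)
    (h : ∀ n : ℕ, ∃ Y ∈ g2Series R, X - Y ∈ filt R (n + d)) : X ∈ g2Series R := by
  intro k
  obtain ⟨Y, hY, hXY⟩ := h (6 * k + 7 - d).toNat
  have := coeff_eq_zero_of_mem_filt hXY (k := k) (by omega)
  rw [HahnSeries.coeff_sub, sub_eq_zero] at this
  rw [this]
  exact hY k

/-- The factors themselves need not have values in `G₂`, but the conjugate is a limit of sums of
iterated commutators. -/
theorem IsExpLim.conj_mem_g2Series {U T T' X : LaurentMat R} (hU : U ∈ filt R 1)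
    (hU' : U ∈ g2Series R) (hT : IsExpLim U T) (hT' : IsExpLim (-U) T') (hX : X ∈ g2Series R) :
    T * X * T' ∈ g2Series R := by
  obtain ⟨d, hd⟩ := exists_mem_filt X
  exact mem_g2Series_of_approx d fun n => ⟨_, sum_mem fun m _ =>
    Submodule.smul_mem _ _ (comm_pow_mem_g2Series hU' hX m), hT.conj_sub_mem hU hT' hd n⟩

/-! ### Derivations and evaluations -/

/-- The coefficientwise action of a derivation. -/
def derivSeries (δ : Derivation ℂ R R) : Module.End ℂ (LaurentMat R) where
  toFun X := X.map (δ : R →ₗ[ℂ] R).mapMatrix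
  map_add' X Y := by ext1; funext k; simp [map_add]
  map_smul' c X := by ext1; funext k; simp

theorem coeff_derivSeries (δ : Derivation ℂ R R) (X : LaurentMat R) (k : ℤ) :
    (derivSeries δ X).coeff k = (δ : R →ₗ[ℂ] R).mapMatrix (X.coeff k) := rfl

theorem derivSeries_mul (δ : Derivation ℂ R R) (X Y : LaurentMat R) :
    derivSeries δ (X * Y) = derivSeries δ X * Y + X * derivSeries δ Y := by
  have hz : ∀ (Z : LaurentMat R) (k : ℤ), Z.coeff k = 0 → (derivSeries δ Z).coeff k = 0 := by
    intro Z k h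
    rw [coeff_derivSeries, h, map_zero]
  obtain ⟨a, ha, hb⟩ := exists_coeff_eq_zero_of_lt₂ X Y
  ext1
  funext k
  rw [coeff_derivSeries, HahnSeries.coeff_add, coeff_mul_eq_sum_Icc ha hb,
    coeff_mul_eq_sum_Icc (fun k hk => hz X k (ha k hk)) hb,
    coeff_mul_eq_sum_Icc ha (fun k hk => hz Y k (hb k hk)), map_sum, ← Finset.sum_add_distrib]
  refine Finset.sum_congr rfl fun i _ => ?_
  ext p q
  simp only [coeff_derivSeries, LinearMap.mapMatrix_apply, Matrix.map_apply, Matrix.mul_apply,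
    Matrix.add_apply, map_sum, Derivation.coeFn_coe, Derivation.leibniz, smul_eq_mul,
    ← Finset.sum_add_distrib]
  exact Finset.sum_congr rfl fun r _ => by ring

theorem derivSeries_mem_filt (δ : Derivation ℂ R R) {X : LaurentMat R} {d : ℤ}
    (hX : X ∈ filt R d) : derivSeries δ X ∈ filt R d := by
  intro k i j h
  rw [coeff_derivSeries, LinearMap.mapMatrix_apply, Matrix.map_apply, hX k i j h, map_zero]

theorem derivSeries_mem_g2Series (δ : Derivation ℂ R R) {X : LaurentMat R}
    (hX : X ∈ g2Series R) : derivSeries δ X ∈ g2Series R := by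
  intro k
  obtain ⟨h, e, f, hk⟩ := hX k
  rw [coeff_derivSeries, hk, linearMap_mapMatrix_g2Matrix]
  exact ⟨_, _, _, rfl⟩

theorem derivSeries_one (δ : Derivation ℂ R R) : derivSeries δ 1 = 0 := by
  have h := derivSeries_mul δ (1 : LaurentMat R) 1
  rw [mul_one, mul_one, one_mul] at h
  simpa using h

/-- `T (-∂ₓ) T⁻¹ + ∂ₓ = Tₓ T⁻¹` has values in `G₂`. -/
theorem IsExpLim.mul_derivSeries_mem_g2Series (δ : Derivation ℂ R R) {U T T' : LaurentMat R}
    (hU : U ∈ filt R 1) (hU' : U ∈ g2Series R) (hT : IsExpLim U T) (hT' : IsExpLim (-U) T') :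
    T * derivSeries δ T' ∈ g2Series R := by
  refine mem_g2Series_of_approx 0 fun N => ?_
  -- The conjugation formula is applied in the algebra of operators on series, to left
  -- multiplication by `U` and the operator `δ`, and then evaluated at `1`.
  let u : Module.End ℂ (LaurentMat R) := LinearMap.mulLeft ℂ U
  let ev : Module.End ℂ (LaurentMat R) →ₗ[ℂ] LaurentMat R := LinearMap.applyₗ 1
  -- By the Leibniz rule the first commutator with `δ` is left multiplication by `-δ U`. The later
  -- ones are therefore left multiplications by iterated commutators in `G₂`, and the term `n = 0`
  -- drops out because `δ 1 = 0`.
  have hcomm (n : ℕ) : (comm u ^ (n + 1)) (derivSeries δ) =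
      -LinearMap.mulLeft ℂ ((comm U ^ n) (derivSeries δ U)) := by
    induction n with
    | zero =>
      ext1 X
      simp [u, derivSeries_mul]
    | succ n ih =>
      rw [pow_succ', Module.End.mul_apply, ih, pow_succ' (comm U), Module.End.mul_apply]
      ext1 X
      simp only [comm_apply, u, LinearMap.sub_apply, LinearMap.neg_apply, Module.End.mul_apply,
        LinearMap.mulLeft_apply, sub_mul, mul_assoc, mul_neg]
      abel
  have htr (V : LaurentMat R) : expTrunc (LinearMap.mulLeft ℂ V) N =
      LinearMap.mulLeft ℂ (expTrunc V N) := by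
    ext1 X
    simp [expTrunc, LinearMap.sum_apply, Finset.sum_mul, LinearMap.pow_mulLeft]
  have h1 := expTrunc_mul_mul_expTrunc_sub_mem u (derivSeries δ) N ((filt R N).comap ev)
    fun a b hab => by
      have hneg : -u = LinearMap.mulLeft ℂ (-U) := by ext1 X; simp [u]
      rw [Submodule.mem_comap, hneg]
      simp only [ev, u, LinearMap.applyₗ_apply_apply, Module.End.mul_apply,
        LinearMap.pow_mulLeft, LinearMap.mulLeft_apply, mul_one]
      exact mul_mem_filt' (pow_mem_filt_one hU a)
        (derivSeries_mem_filt δ (pow_mem_filt_one (neg_mem hU) b)) (by omega)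
  have hneg : -u = LinearMap.mulLeft ℂ (-U) := by ext1 X; simp [u]
  rw [Submodule.mem_comap, hneg, map_sub, map_sum] at h1
  simp only [u, htr] at h1
  simp only [ev, LinearMap.applyₗ_apply_apply, Module.End.mul_apply, LinearMap.mulLeft_apply,
    mul_one, LinearMap.smul_apply] at h1
  refine ⟨∑ n ∈ Finset.range N, (n.factorial : ℂ)⁻¹ • ((comm u ^ n) (derivSeries δ)) 1,
    sum_mem fun n _ => Submodule.smul_mem _ _ ?_, ?_⟩
  · cases n with
    | zero =>
      rw [pow_zero, Module.End.one_apply, derivSeries_one]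
      exact zero_mem _
    | succ n =>
      rw [hcomm, LinearMap.neg_apply, LinearMap.mulLeft_apply, mul_one]
      exact neg_mem (comm_pow_mem_g2Series hU' (derivSeries_mem_g2Series δ hU') n)
  · have h2 : T * derivSeries δ T' - expTrunc U N * derivSeries δ (expTrunc (-U) N) ∈
        filt R N := by
      have h : T * derivSeries δ T' - expTrunc U N * derivSeries δ (expTrunc (-U) N) =
          (T - expTrunc U N) * derivSeries δ T' +
            expTrunc U N * derivSeries δ (T' - expTrunc (-U) N) := by
        rw [map_sub, sub_mul, mul_sub]; abel
      rw [h]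
      exact add_mem (mul_mem_filt' (hT N) (derivSeries_mem_filt δ hT'.mem_filt) (by omega))
        (mul_mem_filt' (expTrunc_mem_filt hU N) (derivSeries_mem_filt δ (hT' N)) (by omega))
    simpa using add_mem h2 h1

end Series

/-! ## The cyclic element `Λ = B + λ A` -/

/-- The matrix with entries `v i` at the places `(i, i + d)`. -/
def band (d : ℤ) (v : Fin 7 → ℤ) : Matrix (Fin 7) (Fin 7) ℤ :=
  Matrix.of fun i j => if ((j : ℕ) : ℤ) - (i : ℕ) = d then v i else 0

section Lam

variable {R : Type*} [CommRing R]

/-- The power `λⁿ` of the spectral parameter. -/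
def lamOver (R : Type*) [CommRing R] (n : ℤ) : LaurentMat R := HahnSeries.single (-n) 1

/-- The element `Λ = B + λ A` over an arbitrary commutative ring. -/
def LamOver (R : Type*) [CommRing R] : LaurentMat R :=
  HahnSeries.single 0 (g2Matrix 0 ![1, 1, 0, 0, 0, 0] 0) +
    lamOver R 1 * HahnSeries.single 0 (g2Matrix 0 0 ![0, 0, 0, 0, 0, 1])

theorem lamOver_mul_comm (n : ℤ) (X : LaurentMat R) : lamOver R n * X = X * lamOver R n := by
  ext1
  funext k
  rw [lamOver, HahnSeries.coeff_single_mul, HahnSeries.coeff_mul_single, one_mul, mul_one]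

theorem coeff_lamOver_mul (n k : ℤ) (X : LaurentMat R) :
    (lamOver R n * X).coeff k = X.coeff (k + n) := by
  rw [lamOver, HahnSeries.coeff_single_mul, one_mul, sub_neg_eq_add]

theorem lamOver_mul_lamOver (m n : ℤ) : lamOver R m * lamOver R n = lamOver R (m + n) := by
  rw [lamOver, lamOver, HahnSeries.single_mul_single, mul_one, lamOver, neg_add]

theorem lamOver_zero : lamOver R 0 = 1 := by
  rw [lamOver, neg_zero, HahnSeries.single_zero_one]

/-- The series `P + λ Q + λ² S` with integral coefficients. -/
def quadSeries (R : Type*) [CommRing R] (P Q S : Matrix (Fin 7) (Fin 7) ℤ) : LaurentMat R :=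
  HahnSeries.single 0 ((Int.castRingHom R).mapMatrix P) +
    HahnSeries.single (-1) ((Int.castRingHom R).mapMatrix Q) +
    HahnSeries.single (-2) ((Int.castRingHom R).mapMatrix S)

/-- Over `ℤ` such identities are decidable; they reach `R` along the canonical homomorphism. -/
theorem g2Matrix_B : g2Matrix 0 ![1, 1, 0, 0, 0, 0] 0 = band 1 ![1, 1, 1, 2, 1, 1, 0] := by
  decide

theorem g2Matrix_A : g2Matrix 0 0 ![0, 0, 0, 0, 0, 1] = band (-5) ![0, 0, 0, 0, 0, 6, 6] := by
  decide

theorem LamOver_eq_quadSeries : LamOver R =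
    quadSeries R (band 1 ![1, 1, 1, 2, 1, 1, 0]) (band (-5) ![0, 0, 0, 0, 0, 6, 6]) 0 := by
  rw [quadSeries, ← g2Matrix_B, ← g2Matrix_A, map_g2Matrix, map_g2Matrix, map_zero,
    HahnSeries.single_eq_zero, add_zero, LamOver, lamOver, HahnSeries.single_mul_single, one_mul,
    add_zero]
  congr 3 <;> (funext i; fin_cases i <;> simp)

/-- The `λ³` part of the product is assumed to vanish, so each further power of `Λ` reduces to
integral matrix identities. -/
theorem LamOver_mul_quadSeries (P Q S : Matrix (Fin 7) (Fin 7) ℤ)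
    {P' Q' S' : Matrix (Fin 7) (Fin 7) ℤ}
    (hP : band 1 ![1, 1, 1, 2, 1, 1, 0] * P = P')
    (hQ : band (-5) ![0, 0, 0, 0, 0, 6, 6] * P + band 1 ![1, 1, 1, 2, 1, 1, 0] * Q = Q')
    (hS : band (-5) ![0, 0, 0, 0, 0, 6, 6] * Q + band 1 ![1, 1, 1, 2, 1, 1, 0] * S = S')
    (h : band (-5) ![0, 0, 0, 0, 0, 6, 6] * S = 0) :
    LamOver R * quadSeries R P Q S = quadSeries R P' Q' S' := by
  subst hP hQ hS
  rw [LamOver_eq_quadSeries]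
  simp only [quadSeries, map_zero, add_zero, add_mul, mul_add,
    HahnSeries.single_mul_single, ← map_mul, h, map_add, zero_add, HahnSeries.single_add]
  norm_num
  abel

/-- `Λ ^ j` is homogeneous of degree `j`; for `j ≤ 5` only the diagonals `j` and `j - 6`, the latter
with a factor `λ`, occur. -/
theorem LamOver_pow_five : LamOver R ^ 5 =
    quadSeries R (band 5 ![2, 2, 0, 0, 0, 0, 0]) (band (-1) ![0, 12, 24, 24, 12, 24, 12]) 0 := by
  rw [pow_succ', pow_succ', pow_succ', pow_succ', pow_one]
  nth_rw 5 [LamOver_eq_quadSeries]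
  rw [LamOver_mul_quadSeries _ _ _ (P' := band 2 ![1, 1, 2, 2, 1, 0, 0])
      (Q' := band (-4) ![0, 0, 0, 0, 6, 12, 6]) (S' := 0) (by decide) (by decide) (by decide)
      (by decide),
    LamOver_mul_quadSeries _ _ _ (P' := band 3 ![1, 2, 2, 2, 0, 0, 0])
      (Q' := band (-3) ![0, 0, 0, 12, 12, 12, 6]) (S' := 0) (by decide) (by decide) (by decide)
      (by decide),
    LamOver_mul_quadSeries _ _ _ (P' := band 4 ![2, 2, 2, 0, 0, 0, 0])
      (Q' := band (-2) ![0, 0, 12, 24, 12, 12, 12]) (S' := 0) (by decide) (by decide) (by decide)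
      (by decide),
    LamOver_mul_quadSeries _ _ _ (P' := band 5 ![2, 2, 0, 0, 0, 0, 0])
      (Q' := band (-1) ![0, 12, 24, 24, 12, 24, 12]) (S' := 0) (by decide) (by decide) (by decide)
      (by decide)]

/-- The polynomial `t ^ 7 - 24 λ t` has distinct roots, namely `0` and the sixth roots of `24 λ`.
This is the source of the semisimplicity of `ad Λ`. -/
theorem LamOver_pow_seven : LamOver R ^ 7 = 24 • (lamOver R 1 * LamOver R) := by
  have h : 24 • (lamOver R 1 * LamOver R) = quadSeries R 0
      (24 • band 1 ![1, 1, 1, 2, 1, 1, 0]) (24 • band (-5) ![0, 0, 0, 0, 0, 6, 6]) := by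
    have hs (k : ℤ) (M : Matrix (Fin 7) (Fin 7) R) :
        (HahnSeries.single k (24 • M) : LaurentMat R) = 24 • HahnSeries.single k M :=
      map_nsmul (HahnSeries.single.addMonoidHom k) 24 M
    rw [LamOver_eq_quadSeries, lamOver]
    simp only [quadSeries, map_zero, add_zero, mul_add, HahnSeries.single_mul_single, one_mul,
      zero_add, map_nsmul, hs, smul_add]
    norm_num
  rw [h, pow_succ', pow_succ', LamOver_pow_five,
    LamOver_mul_quadSeries _ _ _ (P' := band 6 ![2, 0, 0, 0, 0, 0, 0])
      (Q' := band 0 ![12, 24, 24, 24, 24, 24, 12]) (S' := band (-6) ![0, 0, 0, 0, 0, 0, 72])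
      (by decide) (by decide) (by decide) (by decide),
    LamOver_mul_quadSeries _ _ _ (P' := 0) (Q' := 24 • band 1 ![1, 1, 1, 2, 1, 1, 0])
      (S' := 24 • band (-5) ![0, 0, 0, 0, 0, 6, 6]) (by decide) (by decide) (by decide)
      (by decide)]

end Lam

/-! ## The decomposition of the loop algebra under `ad Λ` -/

section Abstract

variable {E : Type*} [Ring E] [Algebra ℂ E]

/-- A polynomial in `y = ad Λ`, `z = λ` and `w = λ⁻¹` that inverts `y` on its image. -/
def adInvOf (y z w : E) : E :=
  -((23887872 : ℂ)⁻¹ • (w ^ 3 *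
    (y ^ 17 - (912 : ℂ) • (z * y ^ 11) - (974016 : ℂ) • (z ^ 2 * y ^ 5))))

theorem commute_adInvOf {f y z w : E} (hy : Commute f y) (hz : Commute f z) (hw : Commute f w) :
    Commute f (adInvOf y z w) :=
  Commute.neg_right (Commute.smul_right ((hw.pow_right _).mul_right
    (((hy.pow_right _).sub_right ((hz.mul_right (hy.pow_right _)).smul_right _)).sub_right
      (((hz.pow_right _).mul_right (hy.pow_right _)).smul_right _))) _)

open scoped IsMulCommutative in
/-- If `l ^ 7 = 24 z l` and `r ^ 7 = 24 z r`, then `l - r` is semisimple. -/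
theorem mul_one_sub_mul_adInvOf {y l r z w : E} (hy : y = l - r) (hlr : Commute l r)
    (hlz : Commute l z)
    (hrz : Commute r z) (hlw : Commute l w) (hrw : Commute r w) (hzw : Commute z w)
    (hl : l ^ 7 = (24 : ℂ) • (z * l)) (hr : r ^ 7 = (24 : ℂ) • (z * r)) (hw : w * z = 1) :
    y * (1 - y * adInvOf y z w) = 0 := by
  subst hy
  have key {C : Type _} [CommRing C] [Algebra ℂ C] (l r z w : C)
      (hl : l ^ 7 = (24 : ℂ) • (z * l)) (hr : r ^ 7 = (24 : ℂ) • (z * r)) (hw : w * z = 1) :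
      (l - r) * (1 - (l - r) * adInvOf (l - r) z w) = 0 := by
    have hk : algebraMap ℂ C (23887872 : ℂ)⁻¹ * 23887872 = 1 := by
      rw [← map_ofNat (algebraMap ℂ C), ← map_mul, inv_mul_cancel₀ (by norm_num), map_one]
    have hw3 : w ^ 3 * z ^ 3 = 1 := by rw [← mul_pow, hw, one_pow]
    simp only [adInvOf, Algebra.smul_def, map_ofNat] at hl hr ⊢
    generalize algebraMap ℂ C (23887872 : ℂ)⁻¹ = k at hk
    -- The eigenvalues of `y = l - r` are differences of roots of `t ^ 7 - 24 z t`. Nonzero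
    -- differences have sixth power `24 z`, `-648 z` or `1536 z`, and the left side is `y (y^6 - 24
    -- z) (y^6 + 648 z) (y^6 - 1536 z)`. Solving for the term linear in `y` gives the constants in
    -- `adInvOf`.
    have rel : (l - r) ^ 19 - 912 * (z * (l - r) ^ 13) - 974016 * (z ^ 2 * (l - r) ^ 7) +
        23887872 * (z ^ 3 * (l - r)) = 0 := by
      linear_combination (l^12 - 19*l^11*r + 171*l^10*r^2 - 969*l^9*r^3 + 3876*l^8*r^4 -
      11628*l^7*r^5 + 27132*l^6*r^6 - 888*l^6*z - 50388*l^5*r^7 + 11400*l^5*r*z + 75582*l^4*r^8 -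
      67032*l^4*r^2*z - 92378*l^3*r^9 + 237576*l^3*r^3*z + 92378*l^2*r^10 - 559056*l^2*r^4*z -
      75582*l*r^11 + 894672*l*r^5*z + 50388*r^12 - 913824*r^6*z - 995328*z^2) * hl +
      (-27132*l^6*r^6 - 295488*l^6*z + 11628*l^5*r^7 + 919296*l^5*r*z - 3876*l^4*r^8 -
      1658016*l^4*r^2*z + 969*l^3*r^9 + 1979496*l^3*r^3*z - 171*l^2*r^10 - 1746936*l^2*r^4*z +
      19*l*r^11 + 1197912*l*r^5*z - r^12 + 888*r^6*z + 995328*z^2) * hr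
    linear_combination k * w ^ 3 * rel - (l - r) * hk - (l - r) * k * 23887872 * hw3
  -- The four elements commute pairwise, so the identity may be checked in the commutative
  -- subalgebra that they generate.
  let s : Set E := {l, r, z, w}
  have : IsMulCommutative (Algebra.adjoin ℂ s) := Algebra.isMulCommutative_adjoin ℂ (by
    rintro a (rfl | rfl | rfl | rfl) b (rfl | rfl | rfl | rfl) <;>
      first | rfl | exact hlr.eq | exact hlz.eq | exact hrz.eq | exact hlr.symm.eq |
        exact hlz.symm.eq | exact hrz.symm.eq | exact hlw.eq | exact hrw.eq | exact hzw.eq |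
        exact hlw.symm.eq | exact hrw.symm.eq | exact hzw.symm.eq)
  exact congrArg Subtype.val (key
    (⟨l, Algebra.subset_adjoin (by simp [s])⟩ : Algebra.adjoin ℂ s)
    ⟨r, Algebra.subset_adjoin (by simp [s])⟩ ⟨z, Algebra.subset_adjoin (by simp [s])⟩
    ⟨w, Algebra.subset_adjoin (by simp [s])⟩ (Subtype.ext hl) (Subtype.ext hr) (Subtype.ext hw))

end Abstract

section Decomposition

variable {R : Type*} [CommRing R] [Algebra ℂ R]

theorem lamOver_mem_filt (n : ℤ) : lamOver R n ∈ filt R (-6 * n) := by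
  intro k i j h
  rw [lamOver]
  by_cases hk : k = -n
  · rw [hk, HahnSeries.coeff_single_same]
    refine Matrix.one_apply_ne fun hij => ?_
    subst hij
    omega
  · rw [HahnSeries.coeff_single_of_ne hk]
    rfl

theorem single_band_mem_filt (k d : ℤ) (v : Fin 7 → ℤ) :
    (HahnSeries.single k ((Int.castRingHom R).mapMatrix (band d v)) : LaurentMat R) ∈
      filt R (6 * k - d) := by
  intro m i j h
  by_cases hk : m = k
  · rw [hk, HahnSeries.coeff_single_same, RingHom.mapMatrix_apply, Matrix.map_apply, band,
      Matrix.of_apply, if_neg (by omega), map_zero]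
  · rw [HahnSeries.coeff_single_of_ne hk]
    rfl

theorem quadSeries_band_mem_filt (d : ℤ) (v w : Fin 7 → ℤ) :
    quadSeries R (band d v) (band (d - 6) w) 0 ∈ filt R (-d) := by
  rw [quadSeries, map_zero, HahnSeries.single_eq_zero, add_zero]
  exact add_mem (filt_anti (by omega) (single_band_mem_filt 0 d v))
    (filt_anti (by omega) (single_band_mem_filt (-1) (d - 6) w))

theorem LamOver_mem_filt : LamOver R ∈ filt R (-1) := by
  rw [LamOver_eq_quadSeries]
  exact quadSeries_band_mem_filt 1 _ _

theorem single_mem_g2Series {M : Matrix (Fin 7) (Fin 7) R} (hM : M ∈ g2Mat R) (k : ℤ) :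
    (HahnSeries.single k M : LaurentMat R) ∈ g2Series R := by
  intro m
  by_cases hk : m = k
  · rwa [hk, HahnSeries.coeff_single_same]
  · rw [HahnSeries.coeff_single_of_ne hk]
    exact zero_mem _

theorem lamOver_mul_mem_g2Series {X : LaurentMat R} (hX : X ∈ g2Series R) (n : ℤ) :
    lamOver R n * X ∈ g2Series R := by
  intro k
  rw [coeff_lamOver_mul]
  exact hX _

theorem LamOver_mem_g2Series : LamOver R ∈ g2Series R :=
  add_mem (single_mem_g2Series ⟨_, _, _, rfl⟩ _)
    (lamOver_mul_mem_g2Series (single_mem_g2Series ⟨_, _, _, rfl⟩ _) _)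

theorem LamOver_pow_five_mem_filt : LamOver R ^ 5 ∈ filt R (-5) := by
  rw [LamOver_pow_five]
  exact quadSeries_band_mem_filt 5 _ _

/-- The factor `3` clears a denominator: `Λ ^ 5` has coordinate `1/3` along `E₆`. -/
theorem mapMatrix_mem_g2Mat {M : Matrix (Fin 7) (Fin 7) ℤ} {h : Fin 2 → ℤ} {e f : Fin 6 → ℤ}
    (hM : 3 • M = g2Matrix h e f) : (Int.castRingHom R).mapMatrix M ∈ g2Mat R := by
  have h3 : (Int.castRingHom R).mapMatrix M =
      (3 : ℂ)⁻¹ • (Int.castRingHom R).mapMatrix (g2Matrix h e f) := by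
    rw [← hM, map_nsmul, ← Nat.cast_smul_eq_nsmul ℂ, smul_smul]
    norm_num
  rw [h3, map_g2Matrix]
  exact Submodule.smul_mem _ _ ⟨_, _, _, rfl⟩

theorem LamOver_pow_five_mem_g2Series : LamOver R ^ 5 ∈ g2Series R := by
  rw [LamOver_pow_five, quadSeries, map_zero, HahnSeries.single_eq_zero, add_zero]
  exact add_mem (single_mem_g2Series (mapMatrix_mem_g2Mat (h := 0) (e := ![0, 0, 0, 0, 0, 1])
    (f := 0) (by decide)) _) (single_mem_g2Series (mapMatrix_mem_g2Mat (h := 0) (e := 0)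
    (f := ![72, 36, 0, 0, 0, 0]) (by decide)) _)

/-- Multiplication by `λⁿ`. -/
def shift (R : Type*) [CommRing R] [Algebra ℂ R] (n : ℤ) : Module.End ℂ (LaurentMat R) :=
  LinearMap.mulLeft ℂ (lamOver R n)

theorem shift_mul_shift (m n : ℤ) : shift R m * shift R n = shift R (m + n) := by
  rw [shift, shift, shift, ← lamOver_mul_lamOver, LinearMap.mulLeft_mul]
  rfl

theorem shift_zero : shift R 0 = 1 := by
  rw [shift, lamOver_zero, LinearMap.mulLeft_one]
  rfl

theorem comm_shift (X : LaurentMat R) (n : ℤ) : Commute (comm X) (shift R n) := by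
  refine LinearMap.ext fun Y => ?_
  simp only [Module.End.mul_apply, comm_apply, shift, LinearMap.mulLeft_apply, mul_sub,
    ← mul_assoc, ← lamOver_mul_comm n X]

theorem commute_shift_shift (m n : ℤ) : Commute (shift R m) (shift R n) := by
  rw [Commute, SemiconjBy, shift_mul_shift, shift_mul_shift, add_comm]

theorem commute_mulLeft_shift (X : LaurentMat R) (n : ℤ) :
    Commute (LinearMap.mulLeft ℂ X) (shift R n) := by
  refine LinearMap.ext fun Y => ?_
  rw [Module.End.mul_apply, Module.End.mul_apply, shift, LinearMap.mulLeft_apply,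
    LinearMap.mulLeft_apply, LinearMap.mulLeft_apply, LinearMap.mulLeft_apply, ← mul_assoc,
    ← mul_assoc, lamOver_mul_comm n X]

theorem commute_mulRight_shift (X : LaurentMat R) (n : ℤ) :
    Commute (LinearMap.mulRight ℂ X) (shift R n) :=
  (LinearMap.commute_mulLeft_right (R := ℂ) _ _).symm

/-- A homogeneous operator of degree `-1` that inverts `ad Λ` on its image. -/
def adInv (R : Type*) [CommRing R] [Algebra ℂ R] : Module.End ℂ (LaurentMat R) :=
  adInvOf (comm (LamOver R)) (shift R 1) (shift R (-1))

/-- An operator that commutes with `ad Λ` and with multiplication by powers of `λ` commutes with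
`adInv`. -/
theorem commute_adInv {f : Module.End ℂ (LaurentMat R)} (hf : Commute f (comm (LamOver R)))
    (hf' : ∀ n, Commute f (shift R n)) : Commute f (adInv R) :=
  commute_adInvOf hf (hf' _) (hf' _)

theorem comm_comm_adInv : Commute (comm (LamOver R)) (adInv R) :=
  commute_adInv (Commute.refl _) (comm_shift _)

theorem mulLeft_LamOver_pow_seven : LinearMap.mulLeft ℂ (LamOver R) ^ 7 =
    (24 : ℂ) • (shift R 1 * LinearMap.mulLeft ℂ (LamOver R)) := by
  rw [LinearMap.pow_mulLeft, LamOver_pow_seven, ← Nat.cast_smul_eq_nsmul ℂ, Nat.cast_ofNat]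
  ext1 Y
  rw [LinearMap.smul_apply, Module.End.mul_apply]
  simp only [shift, LinearMap.mulLeft_apply, smul_mul_assoc, mul_assoc]

theorem mulRight_LamOver_pow_seven : LinearMap.mulRight ℂ (LamOver R) ^ 7 =
    (24 : ℂ) • (shift R 1 * LinearMap.mulRight ℂ (LamOver R)) := by
  rw [LinearMap.pow_mulRight, LamOver_pow_seven, ← Nat.cast_smul_eq_nsmul ℂ, Nat.cast_ofNat]
  ext1 Y
  rw [LinearMap.smul_apply, Module.End.mul_apply]
  rw [shift, LinearMap.mulLeft_apply, LinearMap.mulRight_apply, LinearMap.mulRight_apply,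
    mul_smul_comm, ← mul_assoc, ← mul_assoc, lamOver_mul_comm 1 Y]

theorem comm_mul_one_sub_comm_mul_adInv :
    comm (LamOver R) * (1 - comm (LamOver R) * adInv R) = 0 := by
  have hw : shift R (-1) * shift R 1 = 1 := by
    rw [shift_mul_shift]
    exact shift_zero
  have hy : comm (LamOver R) =
      LinearMap.mulLeft ℂ (LamOver R) - LinearMap.mulRight ℂ (LamOver R) := rfl
  have h := mul_one_sub_mul_adInvOf (y := comm (LamOver R)) (z := shift R 1) (w := shift R (-1)) hy
    (LinearMap.commute_mulLeft_right (R := ℂ) _ _) (commute_mulLeft_shift _ _)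
    (commute_mulRight_shift _ _) (commute_mulLeft_shift _ _) (commute_mulRight_shift _ _)
    (commute_shift_shift _ _) mulLeft_LamOver_pow_seven mulRight_LamOver_pow_seven hw
  rw [adInv]
  with_reducible exact h

theorem comm_LamOver_mem_filt {X : LaurentMat R} {d : ℤ} (hX : X ∈ filt R d) :
    comm (LamOver R) X ∈ filt R (d - 1) :=
  sub_mem (mul_mem_filt' LamOver_mem_filt hX (by omega))
    (mul_mem_filt' hX LamOver_mem_filt (by omega))

theorem comm_LamOver_pow_mem_filt {X : LaurentMat R} {d : ℤ} (hX : X ∈ filt R d) (n : ℕ) :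
    (comm (LamOver R) ^ n) X ∈ filt R (d - n) := by
  induction n with
  | zero => simpa using hX
  | succ n ih =>
    rw [pow_succ', Module.End.mul_apply]
    exact filt_anti (by push_cast; omega) (comm_LamOver_mem_filt ih)

theorem shift_pow (n : ℤ) (m : ℕ) : shift R n ^ m = shift R (m * n) := by
  induction m with
  | zero => rw [pow_zero, Nat.cast_zero, zero_mul, shift_zero]
  | succ m ih => rw [pow_succ, ih, shift_mul_shift, Nat.cast_succ, add_one_mul]

theorem adInv_apply (X : LaurentMat R) : adInv R X = -((23887872 : ℂ)⁻¹ • (shift R (-3) (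
    (comm (LamOver R) ^ 17) X - (912 : ℂ) • shift R 1 ((comm (LamOver R) ^ 11) X) -
      (974016 : ℂ) • shift R 2 ((comm (LamOver R) ^ 5) X)))) := by
  rw [adInv, adInvOf, shift_pow, shift_pow]
  simp only [LinearMap.neg_apply, LinearMap.smul_apply, Module.End.mul_apply, LinearMap.sub_apply]
  norm_num

theorem shift_mem_filt {X : LaurentMat R} {d : ℤ} (hX : X ∈ filt R d) (n : ℤ) :
    shift R n X ∈ filt R (d - 6 * n) :=
  mul_mem_filt' (lamOver_mem_filt n) hX (by omega)

/-- Each of the three terms loses `17` orders before the factor `λ⁻³` gains `18`. -/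
theorem adInv_mem_filt {X : LaurentMat R} {d : ℤ} (hX : X ∈ filt R d) :
    adInv R X ∈ filt R (d + 1) := by
  rw [adInv_apply]
  refine neg_mem (Submodule.smul_mem _ _ (filt_anti (by omega)
    (shift_mem_filt (d := d - 17) (sub_mem (sub_mem ?_ (Submodule.smul_mem _ _ ?_))
      (Submodule.smul_mem _ _ ?_)) (-3))))
  · exact comm_LamOver_pow_mem_filt hX 17
  · exact filt_anti (by omega) (shift_mem_filt (comm_LamOver_pow_mem_filt hX 11) 1)
  · exact filt_anti (by omega) (shift_mem_filt (comm_LamOver_pow_mem_filt hX 5) 2)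

theorem adInv_mem_g2Series {X : LaurentMat R} (hX : X ∈ g2Series R) :
    adInv R X ∈ g2Series R := by
  have h (n : ℕ) := comm_pow_mem_g2Series LamOver_mem_g2Series hX n
  rw [adInv_apply]
  exact neg_mem (Submodule.smul_mem _ _ (lamOver_mul_mem_g2Series (sub_mem (sub_mem (h 17)
    (Submodule.smul_mem _ _ (lamOver_mul_mem_g2Series (h 11) _)))
    (Submodule.smul_mem _ _ (lamOver_mul_mem_g2Series (h 5) _))) _))

/-- The projection to the image of `ad Λ` along the centralizer of `Λ`. -/
def imProj (R : Type*) [CommRing R] [Algebra ℂ R] : Module.End ℂ (LaurentMat R) :=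
  comm (LamOver R) * adInv R

theorem imProj_apply (X : LaurentMat R) : imProj R X = comm (LamOver R) (adInv R X) := by
  rw [imProj, Module.End.mul_apply]

theorem comm_imProj (X : LaurentMat R) :
    comm (LamOver R) (imProj R X) = comm (LamOver R) X := by
  have h : (comm (LamOver R) * (1 - imProj R)) X = 0 := by
    rw [imProj, comm_mul_one_sub_comm_mul_adInv, LinearMap.zero_apply]
  rw [mul_sub, mul_one, LinearMap.sub_apply, sub_eq_zero, Module.End.mul_apply] at h
  exact h.symm

theorem imProj_eq_adInv_comm (X : LaurentMat R) :
    imProj R X = adInv R (comm (LamOver R) X) := by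
  rw [imProj, comm_comm_adInv.eq, Module.End.mul_apply]

theorem imProj_eq_zero_of_comm {X : LaurentMat R} (hX : comm (LamOver R) X = 0) :
    imProj R X = 0 := by
  rw [imProj_eq_adInv_comm, hX, map_zero]

theorem imProj_imProj (X : LaurentMat R) : imProj R (imProj R X) = imProj R X := by
  rw [imProj_eq_adInv_comm, comm_imProj, ← imProj_eq_adInv_comm]

theorem imProj_mem_filt {X : LaurentMat R} {d : ℤ} (hX : X ∈ filt R d) :
    imProj R X ∈ filt R d := by
  rw [imProj_apply]
  exact filt_anti (by omega) (comm_LamOver_mem_filt (adInv_mem_filt hX))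

theorem imProj_mem_g2Series {X : LaurentMat R} (hX : X ∈ g2Series R) :
    imProj R X ∈ g2Series R := by
  rw [imProj_apply]
  exact comm_mem_g2Series LamOver_mem_g2Series (adInv_mem_g2Series hX)

attribute [irreducible] adInv imProj

end Decomposition

/-! ## Gauge transformations and the dressing construction -/

section Gauge

variable {R : Type*} [CommRing R] [Algebra ℂ R]

/-- The potential `T L T⁻¹ + Tₓ T⁻¹` of the operator `T (-∂ₓ + L) T⁻¹`. -/
def gauge (δ : Derivation ℂ R R) (L : LaurentMat R) (T : (LaurentMat R)ˣ) : LaurentMat R :=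
  T * L * (T⁻¹ : (LaurentMat R)ˣ) + derivSeries δ T * (T⁻¹ : (LaurentMat R)ˣ)

theorem derivSeries_mul_inv (δ : Derivation ℂ R R) (T : (LaurentMat R)ˣ) :
    derivSeries δ T * (T⁻¹ : (LaurentMat R)ˣ) = -(T * derivSeries δ (T⁻¹ : (LaurentMat R)ˣ)) := by
  have h := derivSeries_mul δ (T : LaurentMat R) (T⁻¹ : (LaurentMat R)ˣ)
  rw [Units.mul_inv, derivSeries_one] at h
  exact eq_neg_of_add_eq_zero_left h.symm

theorem gauge_mem_g2Series (δ : Derivation ℂ R R) {L U : LaurentMat R} {T : (LaurentMat R)ˣ}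
    (hL : L ∈ g2Series R) (hU : U ∈ filt R 1) (hU' : U ∈ g2Series R) (hT : IsExpLim U T) :
    gauge δ L T ∈ g2Series R := by
  refine add_mem (hT.conj_mem_g2Series hU hU' (hT.inv hU) hL) ?_
  rw [derivSeries_mul_inv]
  exact neg_mem (hT.mul_derivSeries_mem_g2Series δ hU hU' (hT.inv hU))

theorem mul_mul_inv_sub_mem_filt {L : LaurentMat R} {T : (LaurentMat R)ˣ} {d : ℤ}
    (hL : L ∈ filt R (d - 1)) (hT : (T : LaurentMat R) - 1 ∈ filt R 1) :
    T * L * (T⁻¹ : (LaurentMat R)ˣ) - L ∈ filt R d := by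
  have h : T * L * (T⁻¹ : (LaurentMat R)ˣ) - L =
      ((T : LaurentMat R) - 1) * L * (T⁻¹ : (LaurentMat R)ˣ) +
        L * (((T⁻¹ : (LaurentMat R)ˣ) : LaurentMat R) - 1) := by noncomm_ring
  rw [h]
  exact add_mem (mul_mem_filt' (mul_mem_filt hT hL) (inv_mem_filt hT) (by omega))
    (mul_mem_filt' hL (inv_sub_one_mem_filt hT) (by omega))

theorem mem_filt_of_sub_LamOver {L : LaurentMat R} (hL : L - LamOver R ∈ filt R 0) :
    L ∈ filt R (-1) := by
  have := add_mem (filt_anti (by omega) hL) (LamOver_mem_filt (R := R))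
  simpa using this

theorem gauge_sub_LamOver_mem_filt (δ : Derivation ℂ R R) {L : LaurentMat R}
    {T : (LaurentMat R)ˣ} (hL : L - LamOver R ∈ filt R 0)
    (hT : (T : LaurentMat R) - 1 ∈ filt R 1) : gauge δ L T - LamOver R ∈ filt R 0 := by
  have h : gauge δ L T - LamOver R = (T * L * (T⁻¹ : (LaurentMat R)ˣ) - L) + (L - LamOver R) +
      derivSeries δ T * (T⁻¹ : (LaurentMat R)ˣ) := by
    rw [gauge]; abel
  rw [h]
  exact add_mem (add_mem (mul_mul_inv_sub_mem_filt (mem_filt_of_sub_LamOver hL) hT) hL)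
    (mul_mem_filt' (derivSeries_mem_filt δ (mem_filt_of_sub_one hT)) (inv_mem_filt hT) (by omega))

/-- The first variation of the gauge transform in the direction of `u`. -/
theorem gauge_sub_gauge_sub_mem_filt (δ : Derivation ℂ R R) {L u : LaurentMat R}
    {T T' : (LaurentMat R)ˣ} {n : ℕ} (hL : L - LamOver R ∈ filt R 0)
    (hT : (T : LaurentMat R) - 1 ∈ filt R 1) (hT' : (T' : LaurentMat R) - 1 ∈ filt R 1)
    (hu : u ∈ filt R (n + 1)) (h : (T' : LaurentMat R) - T - u ∈ filt R (n + 2))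
    (h' : ((T'⁻¹ : (LaurentMat R)ˣ) : LaurentMat R) - (T⁻¹ : (LaurentMat R)ˣ) + u ∈
      filt R (n + 2)) :
    gauge δ L T' - gauge δ L T + comm (LamOver R) u ∈ filt R (n + 1) := by
  have hL' := mem_filt_of_sub_LamOver hL
  have h1 : L * (T'⁻¹ : (LaurentMat R)ˣ) - LamOver R ∈ filt R 0 := by
    have e : L * (T'⁻¹ : (LaurentMat R)ˣ) - LamOver R =
        L * (((T'⁻¹ : (LaurentMat R)ˣ) : LaurentMat R) - 1) + (L - LamOver R) := by noncomm_ring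
    rw [e]
    exact add_mem (mul_mem_filt' hL' (inv_sub_one_mem_filt hT') (by omega)) hL
  have h2 : (T : LaurentMat R) * L - LamOver R ∈ filt R 0 := by
    have e : (T : LaurentMat R) * L - LamOver R =
        ((T : LaurentMat R) - 1) * L + (L - LamOver R) := by noncomm_ring
    rw [e]
    exact add_mem (mul_mem_filt' hT hL' (by omega)) hL
  have h3 : (T' : LaurentMat R) - T ∈ filt R (n + 1) := by
    simpa using add_mem (filt_anti (by omega) h) hu
  have h4 : ((T'⁻¹ : (LaurentMat R)ˣ) : LaurentMat R) - (T⁻¹ : (LaurentMat R)ˣ) ∈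
      filt R (n + 1) := by
    simpa using sub_mem (filt_anti (by omega) h') hu
  -- To leading order `L T'⁻¹` and `T L` are both `Λ`, so the variation is `u Λ - Λ u`. Every
  -- remaining term has order at least `n + 1`.
  have hsum : gauge δ L T' - gauge δ L T + comm (LamOver R) u =
      u * (L * (T'⁻¹ : (LaurentMat R)ˣ) - LamOver R) +
      ((T' : LaurentMat R) - T - u) * L * (T'⁻¹ : (LaurentMat R)ˣ) -
      ((T : LaurentMat R) * L - LamOver R) * u +
      (T : LaurentMat R) * L *
        (((T'⁻¹ : (LaurentMat R)ˣ) : LaurentMat R) - (T⁻¹ : (LaurentMat R)ˣ) + u) +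
      derivSeries δ ((T' : LaurentMat R) - T) * (T'⁻¹ : (LaurentMat R)ˣ) +
      derivSeries δ T *
        (((T'⁻¹ : (LaurentMat R)ˣ) : LaurentMat R) - (T⁻¹ : (LaurentMat R)ˣ)) := by
    rw [gauge, gauge, comm_apply, map_sub]
    noncomm_ring
  rw [hsum]
  have hT0 := mem_filt_of_sub_one hT
  refine add_mem (add_mem (add_mem (sub_mem (add_mem ?_ ?_) ?_) ?_) ?_) ?_
  · exact mul_mem_filt' hu h1 (by omega)
  · exact mul_mem_filt' (mul_mem_filt h hL') (inv_mem_filt hT') (by omega)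
  · exact mul_mem_filt' h2 hu (by omega)
  · exact mul_mem_filt' (mul_mem_filt hT0 hL') h' (by omega)
  · exact mul_mem_filt' (derivSeries_mem_filt δ h3) (inv_mem_filt hT') (by omega)
  · exact mul_mem_filt' (derivSeries_mem_filt δ hT0) h4 (by omega)

/-- The exponential of a series of negative degree, as a unit. -/
def expUnit (U : LaurentMat R) : (LaurentMat R)ˣ :=
  open Classical in if h : U ∈ filt R 1 then (exists_unit_isExpLim h).choose else 1

theorem isExpLim_expUnit {U : LaurentMat R} (hU : U ∈ filt R 1) : IsExpLim U (expUnit U) := by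
  rw [expUnit, dif_pos hU]
  exact (exists_unit_isExpLim hU).choose_spec.1

theorem gauge_expUnit_add_mem_filt (δ : Derivation ℂ R R) {L U V : LaurentMat R} {n : ℕ}
    (hL : L - LamOver R ∈ filt R 0) (hU : U ∈ filt R 1) (hV : V ∈ filt R (n + 1)) :
    gauge δ L (expUnit (U + V)) - gauge δ L (expUnit U) + comm (LamOver R) V ∈
      filt R (n + 1) := by
  have hUV : U + V ∈ filt R 1 := add_mem hU (filt_anti (by omega) hV)
  have h1 := isExpLim_expUnit hU
  have h2 := isExpLim_expUnit hUV
  refine gauge_sub_gauge_sub_mem_filt δ hL h1.sub_one_mem h2.sub_one_mem hV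
    (h1.sub_sub_mem hU hV h2) ?_
  have h3 := (h1.inv hU).sub_sub_mem (neg_mem hU) (neg_mem hV)
    (by rw [← neg_add]; exact h2.inv hUV)
  rwa [sub_neg_eq_add] at h3

/-- The improvement of an approximate dressing `exp U` by one order. -/
def dressStep (δ : Derivation ℂ R R) (L U : LaurentMat R) : LaurentMat R :=
  adInv R (imProj R (gauge δ L (expUnit U) - LamOver R))

/-- The approximations to the logarithm of a dressing. -/
def dressSeq (δ : Derivation ℂ R R) (L : LaurentMat R) : ℕ → LaurentMat R
  | 0 => 0
  | n + 1 => dressSeq δ L n + dressStep δ L (dressSeq δ L n)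

/-- The image component of the error has order `n`, and applying `adInv` to it gives a correction
`V` of order `n + 1` whose bracket `[Λ, V]` is exactly that component. The first variation `-[Λ, V]`
cancels it, leaving order `n + 1`. -/
theorem dressSeq_mem (δ : Derivation ℂ R R) {L : LaurentMat R} (hL : L - LamOver R ∈ filt R 0)
    (hL' : L ∈ g2Series R) (n : ℕ) :
    dressSeq δ L n ∈ filt R 1 ∧ dressSeq δ L n ∈ g2Series R ∧
      imProj R (gauge δ L (expUnit (dressSeq δ L n)) - LamOver R) ∈ filt R n := by
  induction n with
  | zero =>
    refine ⟨zero_mem _, zero_mem _, imProj_mem_filt (gauge_sub_LamOver_mem_filt δ hL ?_)⟩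
    exact (isExpLim_expUnit (zero_mem _)).sub_one_mem
  | succ n ih =>
    obtain ⟨h1, h2, h3⟩ := ih
    have hs : dressStep δ L (dressSeq δ L n) ∈ filt R (n + 1) := by
      rw [dressStep]
      exact adInv_mem_filt h3
    refine ⟨add_mem h1 (filt_anti (by omega) hs), add_mem h2 ?_, ?_⟩
    · rw [dressStep]
      exact adInv_mem_g2Series (imProj_mem_g2Series (sub_mem
        (gauge_mem_g2Series δ hL' h1 h2 (isExpLim_expUnit h1)) LamOver_mem_g2Series))
    have h4 := imProj_mem_filt (gauge_expUnit_add_mem_filt δ hL h1 hs)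
    have h5 : comm (LamOver R) (dressStep δ L (dressSeq δ L n)) =
        imProj R (gauge δ L (expUnit (dressSeq δ L n)) - LamOver R) := by
      rw [dressStep, ← imProj_apply, imProj_imProj]
    rw [map_add, h5, imProj_imProj, ← map_add] at h4
    rw [dressSeq, Nat.cast_succ]
    convert h4 using 2
    abel

/-- Every potential `L = Λ + lower order` is conjugate to an element of the Heisenberg
subalgebra. -/
theorem exists_gauge_comm_eq_zero (δ : Derivation ℂ R R) {L : LaurentMat R}
    (hL : L - LamOver R ∈ filt R 0) (hL' : L ∈ g2Series R) :
    ∃ U ∈ filt R 1, U ∈ g2Series R ∧ ∃ T : (LaurentMat R)ˣ, IsExpLim U T ∧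
      gauge δ L T - LamOver R ∈ g2Series R ∧ comm (LamOver R) (gauge δ L T - LamOver R) = 0 := by
  have hmem := dressSeq_mem δ hL hL'
  have hs (n : ℕ) : dressStep δ L (dressSeq δ L n) ∈ filt R (n + 1) := by
    rw [dressStep]
    exact adInv_mem_filt (hmem n).2.2
  obtain ⟨U, hU⟩ := exists_sum_filt (fun n => dressStep δ L (dressSeq δ L n))
    fun n => filt_anti (by omega) (hs n)
  have hsum (n : ℕ) : ∑ m ∈ Finset.range n, dressStep δ L (dressSeq δ L m) = dressSeq δ L n := by
    induction n with
    | zero => rfl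
    | succ n ih => rw [Finset.sum_range_succ, ih, dressSeq]
  have hU' (n : ℕ) : U - dressSeq δ L n ∈ filt R (n + 1) := by
    have h1 := hU (n + 1)
    rw [hsum, dressSeq, ← sub_sub, Nat.cast_succ] at h1
    simpa using add_mem h1 (hs n)
  have hU1 : U ∈ filt R 1 := by simpa [dressSeq] using hU' 0
  have hU2 : U ∈ g2Series R := mem_g2Series_of_approx 1 fun n => ⟨_, (hmem n).2.1, hU' n⟩
  have hT := isExpLim_expUnit hU1
  have hX := sub_mem (gauge_mem_g2Series δ hL' hU1 hU2 hT) LamOver_mem_g2Series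
  refine ⟨U, hU1, hU2, expUnit U, hT, hX, ?_⟩
  rw [← comm_imProj]
  suffices h : imProj R (gauge δ L (expUnit U) - LamOver R) = 0 by rw [h, map_zero]
  -- Replacing the `n`-th approximation by the limit changes the potential only in order `n`, so the
  -- image component of the limit has every order.
  refine eq_zero_of_forall_mem_filt fun n => ?_
  have h1 := gauge_expUnit_add_mem_filt δ hL (hmem n).1 (hU' n)
  rw [add_sub_cancel] at h1
  have h2 := imProj_mem_filt (sub_mem (filt_anti (d := n) (by omega) h1)
    (filt_anti (by omega) (comm_LamOver_mem_filt (hU' n))))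
  have h3 := add_mem h2 (hmem n).2.2
  rw [← map_add] at h3
  convert h3 using 2
  abel

/-! ### Uniqueness -/

theorem derivSeries_lamOver_mul (δ : Derivation ℂ R R) (n : ℤ) (X : LaurentMat R) :
    derivSeries δ (lamOver R n * X) = lamOver R n * derivSeries δ X := by
  ext1
  funext k
  rw [coeff_derivSeries, coeff_lamOver_mul, coeff_lamOver_mul, coeff_derivSeries]

theorem derivSeries_quadSeries (δ : Derivation ℂ R R) (P Q S : Matrix (Fin 7) (Fin 7) ℤ) :
    derivSeries δ (quadSeries R P Q S) = 0 := by
  have h (k : ℤ) (M : Matrix (Fin 7) (Fin 7) ℤ) :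
      derivSeries δ (HahnSeries.single k ((Int.castRingHom R).mapMatrix M)) = 0 := by
    ext1
    funext m
    rw [coeff_derivSeries]
    by_cases hm : m = k
    · subst hm
      ext i j
      simp
    · rw [HahnSeries.coeff_single_of_ne hm, map_zero]
      rfl
  rw [quadSeries, map_add, map_add, h, h, h, add_zero, add_zero]

theorem derivSeries_LamOver (δ : Derivation ℂ R R) : derivSeries δ (LamOver R) = 0 := by
  rw [LamOver_eq_quadSeries]
  exact derivSeries_quadSeries δ _ _ _

theorem commute_derivSeries_shift (δ : Derivation ℂ R R) (n : ℤ) :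
    Commute (derivSeries δ) (shift R n) :=
  LinearMap.ext fun X => derivSeries_lamOver_mul δ n X

theorem commute_derivSeries_comm (δ : Derivation ℂ R R) :
    Commute (derivSeries δ) (comm (LamOver R)) := by
  refine LinearMap.ext fun X => ?_
  rw [Module.End.mul_apply, Module.End.mul_apply, comm_apply, comm_apply, map_sub,
    derivSeries_mul, derivSeries_mul, derivSeries_LamOver, zero_mul, mul_zero, zero_add, add_zero]

/-- The projection is a polynomial in `ad Λ` and powers of `λ`. It therefore passes through `δ` and
through multiplication by elements of the centralizer of `Λ`. -/
theorem commute_imProj {f : Module.End ℂ (LaurentMat R)} (hf : Commute f (comm (LamOver R)))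
    (hf' : ∀ n, Commute f (shift R n)) (X : LaurentMat R) : imProj R (f X) = f (imProj R X) := by
  rw [imProj_apply, imProj_apply, ← Module.End.mul_apply, ← Module.End.mul_apply,
    ← Module.End.mul_apply, ← Module.End.mul_apply, mul_assoc, ← (commute_adInv hf hf').eq,
    ← mul_assoc, ← hf.eq, mul_assoc]

theorem commute_mulLeft_comm {H : LaurentMat R} (hH : comm (LamOver R) H = 0) :
    Commute (LinearMap.mulLeft ℂ H) (comm (LamOver R)) := by
  rw [comm_apply, sub_eq_zero] at hH
  refine LinearMap.ext fun X => ?_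
  rw [Module.End.mul_apply, Module.End.mul_apply, comm_apply, comm_apply, LinearMap.mulLeft_apply,
    LinearMap.mulLeft_apply, mul_sub, ← mul_assoc, ← mul_assoc, ← mul_assoc, hH]

theorem commute_mulRight_comm {H : LaurentMat R} (hH : comm (LamOver R) H = 0) :
    Commute (LinearMap.mulRight ℂ H) (comm (LamOver R)) := by
  rw [comm_apply, sub_eq_zero] at hH
  refine LinearMap.ext fun X => ?_
  rw [Module.End.mul_apply, Module.End.mul_apply, comm_apply, comm_apply, LinearMap.mulRight_apply,
    LinearMap.mulRight_apply, sub_mul, mul_assoc, mul_assoc, mul_assoc, hH]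

/-- A unipotent intertwiner between two elements of the Heisenberg subalgebra commutes with `Λ`. -/
theorem comm_eq_zero_of_intertwines (δ : Derivation ℂ R R) {W H H' : LaurentMat R}
    (hW : W - 1 ∈ filt R 1) (hH : H ∈ filt R 0) (hH' : H' ∈ filt R 0)
    (hc : comm (LamOver R) H = 0) (hc' : comm (LamOver R) H' = 0)
    (h : derivSeries δ W = (LamOver R + H') * W - W * (LamOver R + H)) :
    comm (LamOver R) W = 0 := by
  set Z := imProj R W with hZ
  have hZW : imProj R (W - 1) = Z := by
    rw [map_sub, imProj_eq_zero_of_comm (X := (1 : LaurentMat R)) (by simp), sub_zero]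
  -- Every operator in the equation for `W` commutes with the projection, so the image component
  -- satisfies the same equation.
  have h1 : derivSeries δ Z = comm (LamOver R) Z + H' * Z - Z * H := by
    have e : derivSeries δ W = comm (LamOver R) W + LinearMap.mulLeft ℂ H' W -
        LinearMap.mulRight ℂ H W := by
      rw [h, comm_apply, LinearMap.mulLeft_apply, LinearMap.mulRight_apply]
      noncomm_ring
    have e2 := congrArg (imProj R) e
    rw [map_sub, map_add, commute_imProj (commute_derivSeries_comm δ)
      (commute_derivSeries_shift δ), commute_imProj (Commute.refl _) (comm_shift _),
      commute_imProj (commute_mulLeft_comm hc') (commute_mulLeft_shift _),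
      commute_imProj (commute_mulRight_comm hc) (commute_mulRight_shift _)] at e2
    exact e2
  -- If `Z` has order `n`, the equation gives `[Λ, Z]` order `n`. Inverting `ad Λ` on its image then
  -- gives `Z` order `n + 1`.
  have key (n : ℕ) : Z ∈ filt R n := by
    induction n with
    | zero =>
      rw [← hZW]
      exact imProj_mem_filt (filt_anti (by simp) hW)
    | succ n ih =>
      have h2 : comm (LamOver R) Z ∈ filt R n := by
        have e : comm (LamOver R) Z = derivSeries δ Z - H' * Z + Z * H := by rw [h1]; abel
        rw [e]
        exact add_mem (sub_mem (derivSeries_mem_filt δ ih) (mul_mem_filt' hH' ih (by omega)))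
          (mul_mem_filt' ih hH (by omega))
      have h3 := adInv_mem_filt h2
      rw [← imProj_eq_adInv_comm, hZ, imProj_imProj] at h3
      rwa [Nat.cast_succ]
  rw [← comm_imProj, ← hZ, eq_zero_of_forall_mem_filt key, map_zero]

end Gauge

/-! ## The Killing form of `G₂` as a trace form -/

section Coordinates

variable {R : Type*} [CommRing R]

/-- The Cartan coordinates of a matrix of type `G₂`. -/
def coordH (M : Matrix (Fin 7) (Fin 7) R) : Fin 2 → R := ![M 0 0 + M 1 1, M 0 0]

theorem coordH_g2Matrix (h : Fin 2 → R) (e f : Fin 6 → R) : coordH (g2Matrix h e f) = h := by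
  ext i
  fin_cases i <;> simp [coordH, g2Matrix]

variable [Algebra ℂ R]

/-- The coordinates of a matrix of type `G₂` along the positive root vectors. -/
def coordE (M : Matrix (Fin 7) (Fin 7) R) : Fin 6 → R :=
  ![M 1 2, M 0 1, -M 0 2, (2⁻¹ : ℂ) • M 0 3, (-6⁻¹ : ℂ) • M 0 4, (6⁻¹ : ℂ) • M 0 5]

/-- The coordinates of a matrix of type `G₂` along the negative root vectors. -/
def coordF (M : Matrix (Fin 7) (Fin 7) R) : Fin 6 → R :=
  ![M 2 1, M 1 0, M 2 0, (4⁻¹ : ℂ) • M 3 0, (6⁻¹ : ℂ) • M 4 0, (6⁻¹ : ℂ) • M 5 0]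

theorem smul_natCast_mul (c : ℂ) (n : ℕ) (a : R) : c • ((n : R) * a) = (c * n) • a := by
  rw [← nsmul_eq_mul, ← Nat.cast_smul_eq_nsmul ℂ, smul_smul]

theorem inv_two_smul_two_mul (a : R) : (2⁻¹ : ℂ) • (2 * a) = a := by
  simpa using smul_natCast_mul 2⁻¹ 2 a

theorem inv_four_smul_four_mul (a : R) : (4⁻¹ : ℂ) • (4 * a) = a := by
  simpa using smul_natCast_mul 4⁻¹ 4 a

theorem inv_six_smul_six_mul (a : R) : (6⁻¹ : ℂ) • (6 * a) = a := by
  simpa using smul_natCast_mul 6⁻¹ 6 a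

theorem coordE_g2Matrix (h : Fin 2 → R) (e f : Fin 6 → R) : coordE (g2Matrix h e f) = e := by
  ext i
  fin_cases i <;> simp [coordE, g2Matrix, inv_two_smul_two_mul, inv_six_smul_six_mul]

theorem coordF_g2Matrix (h : Fin 2 → R) (e f : Fin 6 → R) : coordF (g2Matrix h e f) = f := by
  ext i
  fin_cases i <;> simp [coordF, g2Matrix, inv_four_smul_four_mul, inv_six_smul_six_mul]

theorem mem_g2Mat_iff {M : Matrix (Fin 7) (Fin 7) R} :
    M ∈ g2Mat R ↔ M = g2Matrix (coordH M) (coordE M) (coordF M) := by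
  refine ⟨?_, fun h => ⟨_, _, _, h⟩⟩
  rintro ⟨h, e, f, rfl⟩
  rw [coordH_g2Matrix, coordE_g2Matrix, coordF_g2Matrix]

end Coordinates

attribute [local instance 100] LieRing.ofAssociativeRing

/-- The coordinates on `g2`. -/
def g2Equiv : g2 ≃ₗ[ℂ] (Fin 2 → ℂ) × (Fin 6 → ℂ) × (Fin 6 → ℂ) where
  toFun M := (coordH M.1, coordE M.1, coordF M.1)
  invFun v := ⟨g2Matrix v.1 v.2.1 v.2.2, _, _, _, rfl⟩
  map_add' := by
    rintro ⟨_, h, e, f, rfl⟩ ⟨_, h', e', f', rfl⟩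
    change (coordH (g2Matrix h e f + g2Matrix h' e' f'), coordE (g2Matrix h e f +
      g2Matrix h' e' f'), coordF (g2Matrix h e f + g2Matrix h' e' f')) = _
    simp only [g2Matrix_add, coordH_g2Matrix, coordE_g2Matrix, coordF_g2Matrix, Prod.mk_add_mk]
  map_smul' := by
    rintro c ⟨_, h, e, f, rfl⟩
    change (coordH (c • g2Matrix h e f), coordE (c • g2Matrix h e f),
      coordF (c • g2Matrix h e f)) = _
    simp only [g2Matrix_smul, coordH_g2Matrix, coordE_g2Matrix, coordF_g2Matrix, Prod.smul_mk,
      RingHom.id_apply]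
  left_inv := by
    rintro ⟨_, h, e, f, rfl⟩
    simp only [coordH_g2Matrix, coordE_g2Matrix, coordF_g2Matrix]
  right_inv := by
    rintro ⟨h, e, f⟩
    simp only [coordH_g2Matrix, coordE_g2Matrix, coordF_g2Matrix]

theorem g2Equiv_lie_symm (h h' : Fin 2 → ℂ) (e f e' f' : Fin 6 → ℂ) :
    g2Equiv ⁅g2Equiv.symm (h, e, f), g2Equiv.symm (h', e', f')⁆ =
      (bracketH e f e' f', bracketE h h' e f e' f', bracketF h h' e f e' f') := by
  change (coordH ⁅g2Matrix h e f, g2Matrix h' e' f'⁆, coordE ⁅g2Matrix h e f, g2Matrix h' e' f'⁆,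
    coordF ⁅g2Matrix h e f, g2Matrix h' e' f'⁆) = _
  rw [Ring.lie_def, g2Matrix_mul_sub_mul, coordH_g2Matrix, coordE_g2Matrix, coordF_g2Matrix]

theorem g2Equiv_lie_lie_symm (h h' h'' : Fin 2 → ℂ) (e f e' f' e'' f'' : Fin 6 → ℂ) :
    g2Equiv ⁅g2Equiv.symm (h, e, f), ⁅g2Equiv.symm (h', e', f'), g2Equiv.symm (h'', e'', f'')⁆⁆ =
      (bracketH e f (bracketE h' h'' e' f' e'' f'') (bracketF h' h'' e' f' e'' f''),
      bracketE h (bracketH e' f' e'' f'') e f (bracketE h' h'' e' f' e'' f'')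
        (bracketF h' h'' e' f' e'' f''),
      bracketF h (bracketH e' f' e'' f'') e f (bracketE h' h'' e' f' e'' f'')
        (bracketF h' h'' e' f' e'' f'')) := by
  rw [← g2Equiv_lie_symm, ← g2Equiv_lie_symm, LinearEquiv.symm_apply_apply]

theorem trace_prod_prod {m n p : Type*} [Fintype m] [Fintype n] [Fintype p] [DecidableEq m]
    [DecidableEq n] [DecidableEq p] (φ : Module.End ℂ ((m → ℂ) × (n → ℂ) × (p → ℂ))) :
    LinearMap.trace ℂ _ φ = ∑ i, (φ (Pi.single i 1, 0, 0)).1 i +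
      (∑ i, (φ (0, Pi.single i 1, 0)).2.1 i + ∑ i, (φ (0, 0, Pi.single i 1)).2.2 i) := by
  rw [LinearMap.trace_eq_matrix_trace ℂ ((Pi.basisFun ℂ m).prod ((Pi.basisFun ℂ n).prod
    (Pi.basisFun ℂ p))), Matrix.trace, Fintype.sum_sum_type, Fintype.sum_sum_type]
  simp [LinearMap.toMatrix_apply]
  rfl

/-- Both sides are polynomials in the coordinates, and the trace over the fourteen basis vectors is
computed outright. The factor `4` is the ratio of the Dynkin indices of the adjoint and the
seven-dimensional representations. -/
theorem killingForm_g2Equiv_symm (h h' : Fin 2 → ℂ) (e f e' f' : Fin 6 → ℂ) :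
    killingForm ℂ g2 (g2Equiv.symm (h, e, f)) (g2Equiv.symm (h', e', f')) =
      4 * (g2Matrix h e f * g2Matrix h' e' f').trace := by
  rw [killingForm_apply_apply, ← LinearMap.trace_conj' _ g2Equiv, trace_prod_prod]
  simp only [LinearEquiv.conj_apply_apply, LinearMap.comp_apply, LieAlgebra.ad_apply,
    g2Equiv_lie_lie_symm]
  simp only [Matrix.trace, Matrix.diag_apply, Matrix.mul_apply, Fin.sum_univ_seven,
    Fin.sum_univ_six, Fin.sum_univ_two, g2Matrix, Matrix.of_apply, Matrix.cons_val]
  simp only [bracketH, bracketE, bracketF, Matrix.cons_val, Pi.single_eq_same, Pi.zero_apply,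
    Pi.single_apply, Fin.reduceEq, if_false, mul_zero, zero_mul, mul_one, one_mul,
    sub_zero, zero_sub, add_zero, zero_add, Fin.isValue]
  ring

theorem killing_eq {X Y : Matrix (Fin 7) (Fin 7) ℂ} (hX : X ∈ g2) (hY : Y ∈ g2) :
    killing X Y = 4 * (X * Y).trace := by
  rw [killing, dif_pos ⟨hX, hY⟩]
  obtain ⟨h, e, f, rfl⟩ := hX
  obtain ⟨h', e', f', rfl⟩ := hY
  exact killingForm_g2Equiv_symm h h' e f e' f'

theorem trace_coeff_mul_comm {R : Type*} [CommRing R] [Algebra ℂ R] (X Y : LaurentMat R) (k : ℤ) :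
    ((X * Y).coeff k).trace = ((Y * X).coeff k).trace := by
  obtain ⟨a, ha, hb⟩ := exists_coeff_eq_zero_of_lt₂ X Y
  rw [coeff_mul_eq_sum_Icc ha hb, coeff_mul_eq_sum_Icc' hb ha, Matrix.trace_sum, Matrix.trace_sum]
  exact Finset.sum_congr rfl fun i _ => Matrix.trace_mul_comm _ _

theorem trace_coeff_derivSeries {R : Type*} [CommRing R] [Algebra ℂ R] (δ : Derivation ℂ R R)
    (X : LaurentMat R) (k : ℤ) : ((derivSeries δ X).coeff k).trace = δ (X.coeff k).trace := by
  rw [coeff_derivSeries, Matrix.trace, Matrix.trace, map_sum]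
  rfl

/-! ## Loops -/

/-- The derivative of loops, as a derivation. -/
def Loop.derivation : Derivation ℂ Loop Loop :=
  Derivation.mk' Loop.d fun f g => by
    ext x
    have h := deriv_mul (f.2.1.differentiable (by simp) x) (g.2.1.differentiable (by simp) x)
    change deriv ((f : ℝ → ℂ) * (g : ℝ → ℂ)) x = (f : ℝ → ℂ) x * deriv (g : ℝ → ℂ) x +
      (g : ℝ → ℂ) x * deriv (f : ℝ → ℂ) x
    rw [h]
    ring

theorem dx_eq (X : Series) : dx X = derivSeries Loop.derivation X := rfl

theorem Lam_eq : Lam = LamOver Loop := rfl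

theorem lam_eq (n : ℤ) : lam n = lamOver Loop n := rfl

/-- Evaluation of loops at a point. -/
def Loop.evalHom (x : ℝ) : Loop →ₐ[ℂ] ℂ := (Pi.evalAlgHom ℂ (fun _ : ℝ => ℂ) x).comp Loop.val

theorem MatLoop.eval_eq (M : MatLoop) (x : ℝ) :
    M.eval x = (Loop.evalHom x).toRingHom.mapMatrix M := rfl

theorem Loop.ext_evalHom {f g : Loop} (h : ∀ x, Loop.evalHom x f = Loop.evalHom x g) : f = g :=
  Subtype.ext (funext h)

theorem mem_g2_iff {M : Matrix (Fin 7) (Fin 7) ℂ} : M ∈ g2 ↔ M ∈ g2Mat ℂ := Iff.rfl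

theorem comp_coord_eq {R R' : Type*} [CommRing R] [Algebra ℂ R] [CommRing R'] [Algebra ℂ R']
    (φ : R →ₐ[ℂ] R') (M : Matrix (Fin 7) (Fin 7) R) :
    φ ∘ coordH M = coordH (φ.toRingHom.mapMatrix M) ∧
      φ ∘ coordE M = coordE (φ.toRingHom.mapMatrix M) ∧
      φ ∘ coordF M = coordF (φ.toRingHom.mapMatrix M) := by
  refine ⟨?_, ?_, ?_⟩ <;> ext i <;> fin_cases i <;> simp [coordH, coordE, coordF]

/-- Pointwise membership gives smooth coordinates because the coordinates are fixed linear
combinations of matrix entries, hence loops themselves. -/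
theorem inG2_iff {X : Series} : InG2 X ↔ X ∈ g2Series Loop := by
  refine ⟨fun h k => ?_, fun h k x => ?_⟩
  · rw [mem_g2Mat_iff]
    ext1 i j
    refine Loop.ext_evalHom fun x => ?_
    have h1 := mem_g2Mat_iff.1 (mem_g2_iff.1 (h k x))
    have h2 := map_g2Matrix (Loop.evalHom x).toRingHom (coordH (X.coeff k)) (coordE (X.coeff k))
      (coordF (X.coeff k))
    obtain ⟨e1, e2, e3⟩ := comp_coord_eq (Loop.evalHom x) (X.coeff k)
    change _ = g2Matrix (Loop.evalHom x ∘ _) (Loop.evalHom x ∘ _) (Loop.evalHom x ∘ _) at h2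
    rw [e1, e2, e3] at h2
    have h3 := h2.trans h1.symm
    exact (congrFun (congrFun h3 i) j).symm
  · obtain ⟨h', e, f, hk⟩ := h k
    rw [hk, MatLoop.eval_eq, map_g2Matrix]
    exact ⟨_, _, _, rfl⟩

theorem inG2Neg_iff {U : Series} : InG2Neg U ↔ U ∈ g2Series Loop ∧ U ∈ filt Loop 1 := by
  rw [InG2Neg, inG2_iff]
  refine and_congr_right fun hU => ⟨fun h k i j hk => ?_, fun h => ⟨fun k hk => ?_, fun i j hij =>
    h 0 i j (by omega)⟩⟩
  · rcases lt_trichotomy k 0 with h0 | rfl | h0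
    · rw [h.1 k h0]
      rfl
    · exact h.2 i j (by omega)
    -- For `k > 0` the only entry of nonnegative degree is the upper right corner at `k = 1`. It has
    -- degree `0` and vanishes for every matrix of type `G₂`.
    · have hi : i = 0 := by omega
      have hj : j = 6 := by omega
      obtain ⟨h', e, f, hk⟩ := hU k
      rw [hk, hi, hj]
      rfl
  · ext1 i j
    exact h k i j (by omega)

theorem finsum_coeff_pow {U : Series} (hU : U ∈ filt Loop 1) {k : ℤ} {N : ℕ} (hN : 6 * k + 6 < N) :
    ∑ᶠ n : ℕ, ((n.factorial : ℂ)⁻¹) • (U ^ n).coeff k = (expTrunc U N).coeff k := by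
  rw [expTrunc, coeff_sum, finsum_eq_sum_of_support_subset]
  · rfl
  · intro n hn
    by_contra hn'
    have hn2 : N ≤ n := by simpa using hn'
    refine hn ?_
    change _ • (U ^ n).coeff k = 0
    rw [coeff_eq_zero_of_mem_filt (pow_mem_filt_one hU n) (by omega), smul_zero]

theorem isExp_iff {U T : Series} (hU : U ∈ filt Loop 1) : IsExp U T ↔ IsExpLim U T := by
  obtain ⟨T', hT'⟩ := exists_isExpLim hU
  have h (k : ℤ) : T'.coeff k = ∑ᶠ n : ℕ, ((n.factorial : ℂ)⁻¹) • (U ^ n).coeff k := by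
    rw [finsum_coeff_pow hU (N := (6 * k + 7).toNat) (by omega)]
    have := coeff_eq_zero_of_mem_filt (hT' (6 * k + 7).toNat) (k := k) (by omega)
    rwa [HahnSeries.coeff_sub, sub_eq_zero] at this
  refine ⟨fun hT => ?_, fun hT => ?_⟩
  · have : T = T' := by
      ext1
      funext k
      rw [hT, h]
    rwa [this]
  · rw [hT.unique hT']
    exact h

/-! ## Dressings as gauge transformations -/

section Tangent

variable {R : Type*} [CommRing R]

/-- The tangent vectors to the symplectic leaf over an arbitrary commutative ring. -/
def tangentOver (q : Fin 6 → R) : Matrix (Fin 7) (Fin 7) R :=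
  g2Matrix ![2 * q 0, q 0] 0 ![q 1, 0, q 2, q 3, q 4, q 5]

theorem tangent_eq (q : Fin 6 → Loop) : tangent q = tangentOver q := rfl

variable [Algebra ℂ R]

theorem single_tangentOver_mem_g2Series (q : Fin 6 → R) :
    (HahnSeries.single 0 (tangentOver q) : LaurentMat R) ∈ g2Series R :=
  single_mem_g2Series ⟨_, _, _, rfl⟩ 0

theorem single_tangentOver_mem_filt (q : Fin 6 → R) :
    (HahnSeries.single 0 (tangentOver q) : LaurentMat R) ∈ filt R 0 := by
  intro k i j hk
  by_cases h : k = 0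
  · subst h
    rw [HahnSeries.coeff_single_same, tangentOver]
    fin_cases i <;> fin_cases j <;> first | (exfalso; simp at hk; done) | simp [g2Matrix]
  · rw [HahnSeries.coeff_single_of_ne h]
    rfl

end Tangent

theorem lax_sub_Lam (q : Fin 6 → Loop) :
    lax q - LamOver Loop = HahnSeries.single 0 (tangentOver q) := by
  have h : const (point q) = const matB + const (tangent q) :=
    HahnSeries.single_add 0 matB (tangent q)
  rw [← Lam_eq, lax, Lam, h, ← tangent_eq, const, const, const]
  abel

theorem lax_sub_Lam_mem_filt (q : Fin 6 → Loop) : lax q - LamOver Loop ∈ filt Loop 0 := by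
  rw [lax_sub_Lam]
  exact single_tangentOver_mem_filt q

theorem lax_mem_g2Series (q : Fin 6 → Loop) : lax q ∈ g2Series Loop := by
  have h := add_mem (single_tangentOver_mem_g2Series q) (LamOver_mem_g2Series (R := Loop))
  rwa [← lax_sub_Lam, sub_add_cancel] at h

theorem momentum_eq (q : Fin 6 → Loop) (T : Seriesˣ) :
    momentum q T = gauge Loop.derivation (lax q) T := rfl

theorem inHeisenberg_iff {X : Series} :
    InHeisenberg X ↔ X ∈ g2Series Loop ∧ comm (LamOver Loop) X = 0 := by
  rw [InHeisenberg, inG2_iff, Ring.lie_def, comm_apply, ← Lam_eq, sub_eq_zero, sub_eq_zero,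
    eq_comm (a := X * Lam)]

theorem mul_diffOp_inv_mul (q : Fin 6 → Loop) (T : Seriesˣ) (Y : Series) :
    (T : Series) * diffOp (lax q) ((T⁻¹ : Seriesˣ) * Y) = diffOp (momentum q T) Y := by
  rw [diffOp, diffOp, dx_eq, dx_eq, derivSeries_mul, momentum_eq, gauge, derivSeries_mul_inv,
    mul_add, mul_neg, mul_add, Units.mul_inv_cancel_left]
  noncomm_ring

/-- The conjugated operator is `-∂ₓ` plus the potential `gauge`, so the Heisenberg part is
determined: applying both operators to `1` recovers it. -/
theorem isDressing_iff {q : Fin 6 → Loop} {T : Seriesˣ} : IsDressing q T ↔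
    (∃ U ∈ filt Loop 1, U ∈ g2Series Loop ∧ IsExpLim U T) ∧
      InHeisenberg (gauge Loop.derivation (lax q) T - LamOver Loop) := by
  refine and_congr ⟨?_, ?_⟩ ⟨?_, fun h => ⟨_, h, fun Y => ?_⟩⟩
  · rintro ⟨U, hU, hT⟩
    obtain ⟨h1, h2⟩ := inG2Neg_iff.1 hU
    exact ⟨U, h2, h1, (isExp_iff h2).1 hT⟩
  · rintro ⟨U, h2, h1, hT⟩
    exact ⟨U, inG2Neg_iff.2 ⟨h1, h2⟩, (isExp_iff h2).2 hT⟩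
  · rintro ⟨H, hH, h⟩
    have h1 := h 1
    rw [mul_diffOp_inv_mul, diffOp, diffOp, mul_one, mul_one, add_right_inj, momentum_eq] at h1
    rwa [h1, Lam_eq, add_sub_cancel_left]
  · rw [mul_diffOp_inv_mul, momentum_eq, Lam_eq, add_sub_cancel]

theorem exists_isDressing (q : Fin 6 → Loop) : ∃ T : Seriesˣ, IsDressing q T := by
  obtain ⟨U, h1, h2, T, hT, h3, h4⟩ :=
    exists_gauge_comm_eq_zero Loop.derivation (lax_sub_Lam_mem_filt q) (lax_mem_g2Series q)
  exact ⟨T, isDressing_iff.2 ⟨⟨U, h1, h2, hT⟩, inHeisenberg_iff.2 ⟨h3, h4⟩⟩⟩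

/-! ## The Heisenberg subalgebra -/

section Heisenberg

variable {R : Type*} [CommRing R]

/-- The generators `Λ^j`, `j ≡ ±1 mod 6`, of the Heisenberg subalgebra. -/
def LamPowOver (R : Type*) [CommRing R] (j : ℤ) : LaurentMat R :=
  if j % 6 = 1 then lamOver R (j / 6) * LamOver R
  else if j % 6 = 5 then lamOver R (j / 6) * LamOver R ^ 5
  else 0

theorem LamPow_eq (j : ℤ) : LamPow j = LamPowOver Loop j := rfl

theorem LamPowOver_induction {p : LaurentMat R → Prop} (h0 : p 0)
    (h1 : ∀ n, p (lamOver R n * LamOver R)) (h5 : ∀ n, p (lamOver R n * LamOver R ^ 5)) (j : ℤ) :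
    p (LamPowOver R j) := by
  rw [LamPowOver]
  split_ifs
  exacts [h1 _, h5 _, h0]

variable [Algebra ℂ R]

theorem LamPowOver_mem_filt (j : ℤ) : LamPowOver R j ∈ filt R (-j) := by
  rw [LamPowOver]
  split_ifs
  · exact mul_mem_filt' (lamOver_mem_filt _) LamOver_mem_filt (by omega)
  · exact mul_mem_filt' (lamOver_mem_filt _) LamOver_pow_five_mem_filt (by omega)
  · exact zero_mem _

theorem LamPowOver_mem_g2Series (j : ℤ) : LamPowOver R j ∈ g2Series R :=
  LamPowOver_induction (zero_mem _) (fun n => lamOver_mul_mem_g2Series LamOver_mem_g2Series n)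
    (fun n => lamOver_mul_mem_g2Series LamOver_pow_five_mem_g2Series n) j

theorem derivSeries_LamPowOver (δ : Derivation ℂ R R) (j : ℤ) :
    derivSeries δ (LamPowOver R j) = 0 := by
  refine LamPowOver_induction (p := fun X => derivSeries δ X = 0) (map_zero _) (fun n => ?_)
    (fun n => ?_) j
  · rw [derivSeries_lamOver_mul, derivSeries_LamOver, mul_zero]
  · rw [derivSeries_lamOver_mul, LamOver_pow_five, derivSeries_quadSeries, mul_zero]

theorem comm_LamPowOver {X : LaurentMat R} (hX : comm (LamOver R) X = 0) (j : ℤ) :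
    comm X (LamPowOver R j) = 0 := by
  have h : Commute X (LamOver R) := (sub_eq_zero.1 hX).symm
  have h' (n : ℤ) : Commute X (lamOver R n) := (lamOver_mul_comm n X).symm
  have hcomm {Y : LaurentMat R} (hY : Commute X Y) : comm X Y = 0 := sub_eq_zero.2 hY
  exact LamPowOver_induction (p := fun Y => comm X Y = 0) (map_zero _)
    (fun n => hcomm ((h' n).mul_right h)) (fun n => hcomm ((h' n).mul_right (h.pow_right 5))) j

/-- The limits of linear combinations of the `Λ^j`, `j ≡ ±1 mod 6`. -/
def IsHeis (X : LaurentMat R) : Prop :=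
  ∀ n : ℕ, ∃ Y ∈ Submodule.span ℂ (Set.range (LamPowOver R)), X - Y ∈ filt R n

theorem IsHeis.mem_g2Series {X : LaurentMat R} (hX : IsHeis X) : X ∈ g2Series R := by
  refine mem_g2Series_of_approx 0 fun n => ?_
  obtain ⟨Y, hY, h⟩ := hX n
  refine ⟨Y, ?_, by rwa [add_zero]⟩
  refine Submodule.span_le.2 ?_ hY
  rintro _ ⟨j, rfl⟩
  exact LamPowOver_mem_g2Series j

theorem IsHeis.derivSeries_eq_zero {X : LaurentMat R} (hX : IsHeis X) (δ : Derivation ℂ R R) :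
    derivSeries δ X = 0 := by
  refine eq_zero_of_forall_mem_filt fun n => ?_
  obtain ⟨Y, hY, h⟩ := hX n
  have hY' : Y ∈ LinearMap.ker (derivSeries δ) := by
    refine Submodule.span_le.2 ?_ hY
    rintro _ ⟨j, rfl⟩
    exact derivSeries_LamPowOver δ j
  have := derivSeries_mem_filt δ h
  rwa [map_sub, LinearMap.mem_ker.1 hY', sub_zero] at this

/-- Whatever commutes with `Λ` commutes with each generator, hence with their span, and by
continuity of multiplication with limits. -/
theorem IsHeis.commute {X : LaurentMat R} (hX : IsHeis X) {Z : LaurentMat R}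
    (hZ : comm (LamOver R) Z = 0) : Z * X = X * Z := by
  obtain ⟨d, hd⟩ := exists_mem_filt Z
  refine eq_of_approx d fun n => ?_
  obtain ⟨Y, hY, h⟩ := hX n
  have hY' : Y ∈ LinearMap.ker (comm Z) := by
    refine Submodule.span_le.2 ?_ hY
    rintro _ ⟨j, rfl⟩
    exact comm_LamPowOver hZ j
  have e : Z * X - X * Z = comm Z (X - Y) := by
    rw [map_sub, LinearMap.mem_ker.1 hY', sub_zero, comm_apply]
  rw [e, comm_apply]
  exact sub_mem (mul_mem_filt' hd h (by omega)) (mul_mem_filt' h hd (by omega))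

theorem isHeis_of_isHeisenbergSum {c : ℤ → ℂ} {C : Series} (hC : IsHeisenbergSum c C) :
    IsHeis C := by
  obtain ⟨⟨N, hN⟩, hC⟩ := hC
  intro n
  -- `Λ⁻ʲ` has order `j`, and an entry of order below `n` lies in a coefficient `k` with `6 * k + 6
  -- < n + 12`, so terms beyond `n + 12` do not contribute to it.
  refine ⟨∑ j ∈ Finset.Icc N (n + 12), c j • LamPowOver Loop (-j),
    sum_mem fun j _ => Submodule.smul_mem _ _ (Submodule.subset_span ⟨_, rfl⟩), ?_⟩
  intro k i j hk
  suffices h : C.coeff k =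
      (∑ j ∈ Finset.Icc N ((n : ℤ) + 12), c j • LamPowOver Loop (-j)).coeff k by
    rw [HahnSeries.coeff_sub, h, sub_self]
    rfl
  rw [hC, coeff_sum]
  refine finsum_mem_eq_sum_of_inter_support_eq _ ?_
  ext m
  simp only [Set.mem_inter_iff, Set.mem_ofPred_eq, Function.mem_support, Finset.coe_Icc,
    Set.mem_Icc]
  refine and_congr_left fun hm => ⟨fun _ => ⟨?_, ?_⟩, fun _ => ?_⟩
  · by_contra h
    exact hm (by rw [hN m (by omega), zero_smul])
  · by_contra h
    refine hm ?_
    rw [LamPow_eq, coeff_eq_zero_of_mem_filt (LamPowOver_mem_filt _) (by omega), smul_zero]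
  -- Indices not congruent to `±1` may stay in the finite sum, since `LamPow` is `0` there.
  · by_contra h
    refine hm ?_
    rw [LamPow, if_neg (by omega), if_neg (by omega), HahnSeries.coeff_zero, smul_zero]

end Heisenberg

/-! ## Conjugation by a dressing -/

section Conjugation

variable {R : Type*} [CommRing R]

theorem conj_eq_conj_of_commute {C : LaurentMat R} {T T' : (LaurentMat R)ˣ}
    (h : (T' : LaurentMat R) * (T⁻¹ : (LaurentMat R)ˣ) * C =
      C * (T' * (T⁻¹ : (LaurentMat R)ˣ))) :
    ((T'⁻¹ : (LaurentMat R)ˣ) : LaurentMat R) * C * T' = (T⁻¹ : (LaurentMat R)ˣ) * C * T := by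
  have h1 : (T' : LaurentMat R) * ((T⁻¹ : (LaurentMat R)ˣ) * C * T) = C * T' := by
    have h2 := congrArg (· * (T : LaurentMat R)) h
    simp only [mul_assoc, Units.inv_mul, mul_one] at h2 ⊢
    exact h2
  rw [mul_assoc, ← h1, Units.inv_mul_cancel_left]

variable [Algebra ℂ R]

theorem gauge_mul (δ : Derivation ℂ R R) (L : LaurentMat R) (T : (LaurentMat R)ˣ) :
    gauge δ L T * T = T * L + derivSeries δ T := by
  rw [gauge, add_mul, Units.inv_mul_cancel_right, Units.inv_mul_cancel_right]

theorem derivSeries_eq (δ : Derivation ℂ R R) (L : LaurentMat R) (T : (LaurentMat R)ˣ) :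
    derivSeries δ T = gauge δ L T * T - T * L := by
  rw [gauge_mul, add_sub_cancel_left]

theorem derivSeries_inv (δ : Derivation ℂ R R) (L : LaurentMat R) (T : (LaurentMat R)ˣ) :
    derivSeries δ (T⁻¹ : (LaurentMat R)ˣ) =
      L * (T⁻¹ : (LaurentMat R)ˣ) - (T⁻¹ : (LaurentMat R)ˣ) * gauge δ L T := by
  rw [gauge, derivSeries_mul_inv, mul_add, ← mul_assoc, ← mul_assoc, Units.inv_mul, one_mul,
    mul_neg, Units.inv_mul_cancel_left]
  abel

/-- Substituting the equations for `δ T` and `δ T⁻¹` turns the left side into `T⁻¹ [C, J] T`, with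
`J` the gauge potential. -/
theorem derivSeries_conj_add (δ : Derivation ℂ R R) (L : LaurentMat R) (T : (LaurentMat R)ˣ)
    {C : LaurentMat R} (hC : derivSeries δ C = 0) (h : gauge δ L T * C = C * gauge δ L T) :
    derivSeries δ ((T⁻¹ : (LaurentMat R)ˣ) * C * T) +
      ((T⁻¹ : (LaurentMat R)ˣ) * C * T * L - L * ((T⁻¹ : (LaurentMat R)ˣ) * C * T)) = 0 := by
  have e : derivSeries δ ((T⁻¹ : (LaurentMat R)ˣ) * C * T) +
      ((T⁻¹ : (LaurentMat R)ˣ) * C * T * L - L * ((T⁻¹ : (LaurentMat R)ˣ) * C * T)) =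
      (T⁻¹ : (LaurentMat R)ˣ) * (C * gauge δ L T - gauge δ L T * C) * T := by
    rw [derivSeries_mul, derivSeries_mul, hC, derivSeries_inv δ L, derivSeries_eq δ L]
    noncomm_ring
  rw [e, h, sub_self, mul_zero, zero_mul]

theorem derivSeries_mul_inv_eq (δ : Derivation ℂ R R) (L : LaurentMat R)
    (T T' : (LaurentMat R)ˣ) : derivSeries δ ((T' : LaurentMat R) * (T⁻¹ : (LaurentMat R)ˣ)) =
      gauge δ L T' * (T' * (T⁻¹ : (LaurentMat R)ˣ)) -
        T' * (T⁻¹ : (LaurentMat R)ˣ) * gauge δ L T := by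
  rw [derivSeries_mul, derivSeries_inv δ L, derivSeries_eq δ L]
  noncomm_ring

/-- Two dressings differ by an element that commutes with `Λ`. -/
theorem comm_LamOver_mul_inv (δ : Derivation ℂ R R) {L : LaurentMat R}
    (hL : L - LamOver R ∈ filt R 0) {T T' : (LaurentMat R)ˣ}
    (hT : (T : LaurentMat R) - 1 ∈ filt R 1) (hT' : (T' : LaurentMat R) - 1 ∈ filt R 1)
    (h : comm (LamOver R) (gauge δ L T - LamOver R) = 0)
    (h' : comm (LamOver R) (gauge δ L T' - LamOver R) = 0) :
    comm (LamOver R) ((T' : LaurentMat R) * (T⁻¹ : (LaurentMat R)ˣ)) = 0 := by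
  refine comm_eq_zero_of_intertwines δ ?_ (gauge_sub_LamOver_mem_filt δ hL hT)
    (gauge_sub_LamOver_mem_filt δ hL hT') h h' ?_
  · have e : (T' : LaurentMat R) * (T⁻¹ : (LaurentMat R)ˣ) - 1 =
        ((T' : LaurentMat R) - 1) * (T⁻¹ : (LaurentMat R)ˣ) +
          (((T⁻¹ : (LaurentMat R)ˣ) : LaurentMat R) - 1) := by noncomm_ring
    rw [e]
    exact add_mem (mul_mem_filt' hT' (inv_mem_filt hT) (by omega)) (inv_sub_one_mem_filt hT)
  · rw [add_sub_cancel, add_sub_cancel]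
    exact derivSeries_mul_inv_eq δ L T T'

/-! ### Traces -/

/-- `w` and its derivative need not commute. Under the trace, cyclicity moves factors of `w` past
`X`, which restores the power rule. -/
theorem trace_derivSeries_pow_mul (δ : Derivation ℂ R R) {w X : LaurentMat R}
    (h : w * X = X * w) (n : ℕ) (k : ℤ) :
    ((derivSeries δ (w ^ (n + 1)) * X).coeff k).trace =
      (n + 1 : ℂ) • ((derivSeries δ w * w ^ n * X).coeff k).trace := by
  induction n generalizing X with
  | zero => simp
  | succ n ih =>
    have h1 : derivSeries δ (w ^ (n + 1 + 1)) * X =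
        derivSeries δ w * w ^ (n + 1) * X + w * (derivSeries δ (w ^ (n + 1)) * X) := by
      rw [pow_succ' w (n + 1), derivSeries_mul, add_mul, mul_assoc w]
    have h2 : derivSeries δ w * w ^ n * (X * w) = derivSeries δ w * w ^ (n + 1) * X := by
      rw [← h, pow_succ, ← mul_assoc, ← mul_assoc]
    rw [h1, HahnSeries.coeff_add, Matrix.trace_add, trace_coeff_mul_comm w, mul_assoc _ X w,
      ih (by rw [← mul_assoc, h]), h2, Nat.cast_succ, add_smul ((n : ℂ) + 1), one_smul, add_comm]

/-- The trace of a logarithmic derivative of a unipotent series is an exact derivative. -/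
theorem exists_trace_log_deriv_eq (δ : Derivation ℂ R R) {W : (LaurentMat R)ˣ} {C : LaurentMat R}
    (hW : (W : LaurentMat R) - 1 ∈ filt R 1) (hC : derivSeries δ C = 0)
    (h : (W : LaurentMat R) * C = C * W) (k : ℤ) :
    ∃ r : R, ((derivSeries δ W * (W⁻¹ : (LaurentMat R)ˣ) * C).coeff k).trace = δ r := by
  obtain ⟨d, hd⟩ := exists_mem_filt C
  set w : LaurentMat R := W - 1 with hw
  have hw' : w ∈ filt R 0 := filt_anti (by omega) hW
  have hwC : w * C = C * w := by rw [hw, sub_mul, mul_sub, h, one_mul, mul_one]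
  -- Large enough that the remainder of the geometric series, of order at least `N + d`, misses the
  -- coefficient `k`.
  set N : ℕ := (6 * k + 7 - d).toNat
  have hdw : derivSeries δ (W : LaurentMat R) = derivSeries δ w := by
    rw [hw, map_sub, derivSeries_one, sub_zero]
  have hinv : ((W⁻¹ : (LaurentMat R)ˣ) : LaurentMat R) =
      ∑ n ∈ Finset.range N, (-w) ^ n + (W⁻¹ : (LaurentMat R)ˣ) * (-w) ^ N := by
    have h1 := mul_neg_geom_sum (-w) N
    have h2 : (1 : LaurentMat R) - -w = W := by rw [hw]; abel
    rw [h2] at h1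
    have h3 := congrArg (fun X => ((W⁻¹ : (LaurentMat R)ˣ) : LaurentMat R) * X) h1
    simp only [Units.inv_mul_cancel_left, mul_sub, mul_one] at h3
    rw [h3, sub_add_cancel]
  have hrem : (derivSeries δ w * ((W⁻¹ : (LaurentMat R)ˣ) * (-w) ^ N) * C).coeff k = 0 := by
    refine coeff_eq_zero_of_mem_filt (d := N + d) (mul_mem_filt' (mul_mem_filt
      (derivSeries_mem_filt δ hw') (mul_mem_filt (inv_mem_filt hW) (pow_mem_filt_one
        (neg_mem hW) N))) hd ?_) ?_
    · omega
    · omega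
  -- Termwise integration of the geometric series: the primitives are the terms of `tr(log(1 + w)
  -- C)`.
  have hterm (n : ℕ) : ((derivSeries δ w * (-w) ^ n * C).coeff k).trace =
      δ (((-1 : ℂ) ^ n * (n + 1 : ℂ)⁻¹) • ((w ^ (n + 1) * C).coeff k).trace) := by
    have hn : (n + 1 : ℂ) ≠ 0 := by exact_mod_cast n.succ_ne_zero
    have e : derivSeries δ w * (-w) ^ n * C = (-1 : ℂ) ^ n • (derivSeries δ w * w ^ n * C) := by
      rw [← neg_one_smul ℂ w, smul_pow, mul_smul_comm, smul_mul_assoc]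
    rw [Derivation.map_smul, ← trace_coeff_derivSeries, derivSeries_mul, hC, mul_zero, add_zero,
      trace_derivSeries_pow_mul δ hwC, smul_smul, inv_mul_cancel_right₀ hn, e,
      HahnSeries.coeff_smul, Matrix.trace_smul]
  refine ⟨∑ n ∈ Finset.range N, ((-1 : ℂ) ^ n * (n + 1 : ℂ)⁻¹) •
    ((w ^ (n + 1) * C).coeff k).trace, ?_⟩
  rw [hdw, hinv, mul_add, add_mul, HahnSeries.coeff_add, hrem, add_zero, Finset.mul_sum,
    Finset.sum_mul, coeff_sum, Matrix.trace_sum, map_sum]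
  exact Finset.sum_congr rfl fun n _ => hterm n

theorem derivSeries_comm {δ δ' : Derivation ℂ R R} (h : ∀ f, δ (δ' f) = δ' (δ f))
    (X : LaurentMat R) : derivSeries δ (derivSeries δ' X) = derivSeries δ' (derivSeries δ X) := by
  ext1
  funext k
  ext1 i j
  exact h _

/-- The derivative of the trace of a gauge transform against a constant element that commutes
with it. -/
theorem deriv_trace_gauge_mul {δ δ' : Derivation ℂ R R} (hδ : ∀ f, δ (δ' f) = δ' (δ f))
    (L : LaurentMat R) (T : (LaurentMat R)ˣ) {C : LaurentMat R} (hC : derivSeries δ C = 0)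
    (hC' : derivSeries δ' C = 0) (h : gauge δ L T * C = C * gauge δ L T) (k : ℤ) :
    δ' ((gauge δ L T * C).coeff k).trace =
      ((derivSeries δ' L * ((T⁻¹ : (LaurentMat R)ˣ) * C * T)).coeff k).trace +
        δ ((derivSeries δ' T * (T⁻¹ : (LaurentMat R)ˣ) * C).coeff k).trace := by
  set J := gauge δ L T with hJ
  set a := derivSeries δ' T * (T⁻¹ : (LaurentMat R)ˣ) with ha
  have ha' : derivSeries δ' T = a * T := by rw [ha, Units.inv_mul_cancel_right]
  -- Applying `δ'` to `J T = T L + δ T`, and using that `δ` and `δ'` commute, gives the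
  -- zero-curvature equation `δ' J = T (δ' L) T⁻¹ + δ a + [a, J]`.
  have h1 : derivSeries δ' J * T =
      T * derivSeries δ' L + derivSeries δ a * T + (a * J - J * a) * T := by
    have e := congrArg (derivSeries δ') (gauge_mul δ L T)
    rw [← hJ, derivSeries_mul, map_add, derivSeries_mul, ← derivSeries_comm hδ, ha',
      derivSeries_mul] at e
    have e2 := derivSeries_eq δ L T
    rw [← hJ] at e2
    rw [e2] at e
    rw [← eq_sub_iff_add_eq] at e
    rw [e]
    noncomm_ring
  have h2 : derivSeries δ' J = T * derivSeries δ' L * (T⁻¹ : (LaurentMat R)ˣ) +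
      derivSeries δ a + (a * J - J * a) := by
    have := congrArg (fun X => X * ((T⁻¹ : (LaurentMat R)ˣ) : LaurentMat R)) h1
    simpa only [add_mul, Units.mul_inv_cancel_right] using this
  have h3 : (((a * J - J * a) * C).coeff k).trace = 0 := by
    rw [sub_mul, HahnSeries.coeff_sub, Matrix.trace_sub, mul_assoc, h, mul_assoc J,
      trace_coeff_mul_comm J, ← mul_assoc, sub_self]
  have h4 : ((T * derivSeries δ' L * (T⁻¹ : (LaurentMat R)ˣ) * C).coeff k).trace =
      ((derivSeries δ' L * ((T⁻¹ : (LaurentMat R)ˣ) * C * T)).coeff k).trace := by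
    rw [mul_assoc (T : LaurentMat R), mul_assoc (T : LaurentMat R), trace_coeff_mul_comm]
    simp only [mul_assoc]
  rw [← trace_coeff_derivSeries, ← trace_coeff_derivSeries, derivSeries_mul, derivSeries_mul, hC,
    hC', mul_zero, mul_zero, add_zero, add_zero, h2, add_mul, add_mul, HahnSeries.coeff_add,
    HahnSeries.coeff_add, Matrix.trace_add, Matrix.trace_add, h3, h4, add_zero]

end Conjugation

/-! ## Integrals of loops -/

theorem Loop.evalHom_apply (f : Loop) (x : ℝ) : Loop.evalHom x f = (f : ℝ → ℂ) x := rfl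

theorem Loop.continuous (f : Loop) : Continuous (f : ℝ → ℂ) := f.2.1.continuous

/-- The integral of a loop. -/
def Loop.integral (f : Loop) : ℂ := ∫ x in (0 : ℝ)..(2 * Real.pi), (f : ℝ → ℂ) x

theorem Loop.integral_add (f g : Loop) :
    Loop.integral (f + g) = Loop.integral f + Loop.integral g :=
  intervalIntegral.integral_add ((Loop.continuous f).intervalIntegrable _ _)
    ((Loop.continuous g).intervalIntegrable _ _)

theorem Loop.integral_derivation (f : Loop) : Loop.integral (Loop.derivation f) = 0 := by
  have h := intervalIntegral.integral_deriv_eq_sub (f := (f : ℝ → ℂ)) (a := 0) (b := 2 * Real.pi)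
    (fun x _ => f.2.1.differentiable (by simp) x)
    ((Loop.continuous (Loop.derivation f)).intervalIntegrable _ _)
  have h2 : (f : ℝ → ℂ) (2 * Real.pi) = (f : ℝ → ℂ) 0 := by
    simpa using f.2.2 0
  rw [h2, sub_self] at h
  exact h

/-- With the Killing form replaced by the trace form, the sum over the antidiagonal becomes a
coefficient of the product, so cyclicity and the Leibniz rule become available. -/
theorem pairing_eq {X Y : Series} (hX : X ∈ g2Series Loop) (hY : Y ∈ g2Series Loop) (k : ℤ) :
    pairing X Y k = 4 * Loop.integral ((X * Y).coeff k).trace := by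
  have h (x : ℝ) : ((((X * Y).coeff k).trace : Loop) : ℝ → ℂ) x =
      ∑ p ∈ Finset.antidiagonal X.isPWO_support Y.isPWO_support k,
        ((X.coeff p.1).eval x * (Y.coeff p.2).eval x).trace := by
    rw [← Loop.evalHom_apply, HahnSeries.coeff_mul, Matrix.trace_sum, map_sum]
    refine Finset.sum_congr rfl fun p _ => ?_
    rw [MatLoop.eval_eq, MatLoop.eval_eq, ← map_mul, Matrix.trace, Matrix.trace, map_sum]
    rfl
  have hcont (p : ℤ × ℤ) : Continuous fun x =>
      ((X.coeff p.1).eval x * (Y.coeff p.2).eval x).trace := by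
    have e (x : ℝ) : ((X.coeff p.1).eval x * (Y.coeff p.2).eval x).trace =
        (((X.coeff p.1 * Y.coeff p.2).trace : Loop) : ℝ → ℂ) x := by
      rw [← Loop.evalHom_apply, MatLoop.eval_eq, MatLoop.eval_eq, ← map_mul, Matrix.trace,
        Matrix.trace, map_sum]
      rfl
    simp only [e]
    exact Loop.continuous _
  simp only [pairing, Loop.integral, h]
  rw [intervalIntegral.integral_finsetSum fun p _ => (hcont p).intervalIntegrable _ _,
    Finset.mul_sum]
  refine Finset.sum_congr rfl fun p _ => ?_
  rw [← intervalIntegral.integral_const_mul]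
  refine intervalIntegral.integral_congr fun x _ => ?_
  exact killing_eq (inG2_iff.2 hX p.1 x) (inG2_iff.2 hY p.2 x)

/-! ## Properties of dressings -/

theorem IsDressing.sub_one_mem {q : Fin 6 → Loop} {T : Seriesˣ} (h : IsDressing q T) :
    (T : Series) - 1 ∈ filt Loop 1 := by
  obtain ⟨⟨U, _, _, hT⟩, _⟩ := isDressing_iff.1 h
  exact hT.sub_one_mem

theorem IsDressing.comm_momentum_sub {q : Fin 6 → Loop} {T : Seriesˣ} (h : IsDressing q T) :
    comm (LamOver Loop) (momentum q T - LamOver Loop) = 0 :=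
  (inHeisenberg_iff.1 (isDressing_iff.1 h).2).2

theorem IsDressing.momentum_mem_g2Series {q : Fin 6 → Loop} {T : Seriesˣ} (h : IsDressing q T) :
    momentum q T ∈ g2Series Loop := by
  have := add_mem (inHeisenberg_iff.1 (isDressing_iff.1 h).2).1 LamOver_mem_g2Series
  rwa [sub_add_cancel] at this

theorem IsDressing.momentum_mul_comm {q : Fin 6 → Loop} {T : Seriesˣ} (h : IsDressing q T)
    {C : Series} (hC : IsHeis C) : momentum q T * C = C * momentum q T := by
  refine hC.commute ?_
  have := h.comm_momentum_sub
  rwa [map_sub, comm_apply _ (LamOver Loop), sub_self, sub_zero] at this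

theorem IsDressing.casimir_mem_g2Series {q : Fin 6 → Loop} {T : Seriesˣ} (h : IsDressing q T)
    {C : Series} (hC : C ∈ g2Series Loop) : casimir T C ∈ g2Series Loop := by
  obtain ⟨⟨U, hU, hU', hT⟩, _⟩ := isDressing_iff.1 h
  exact (hT.inv hU).conj_mem_g2Series (neg_mem hU) (neg_mem hU') (by rwa [neg_neg]) hC

theorem IsDressing.dx_casimir_add {q : Fin 6 → Loop} {T : Seriesˣ} (h : IsDressing q T)
    {C : Series} (hC : IsHeis C) : dx (casimir T C) + ⁅casimir T C, lax q⁆ = 0 :=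
  derivSeries_conj_add Loop.derivation (lax q) T (hC.derivSeries_eq_zero _)
    (h.momentum_mul_comm hC)

theorem IsDressing.mul_inv_commute {q : Fin 6 → Loop} {T T' : Seriesˣ} (h : IsDressing q T)
    (h' : IsDressing q T') {C : Series} (hC : IsHeis C) :
    (T' : Series) * (T⁻¹ : Seriesˣ) * C = C * (T' * (T⁻¹ : Seriesˣ)) :=
  hC.commute (comm_LamOver_mul_inv Loop.derivation (lax_sub_Lam_mem_filt q) h.sub_one_mem
    h'.sub_one_mem h.comm_momentum_sub h'.comm_momentum_sub)

theorem IsDressing.casimir_eq {q : Fin 6 → Loop} {T T' : Seriesˣ} (h : IsDressing q T)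
    (h' : IsDressing q T') {C : Series} (hC : IsHeis C) : casimir T' C = casimir T C :=
  conj_eq_conj_of_commute (h.mul_inv_commute h' hC)

/-- With `W = T' T⁻¹` one has `J' = W J W⁻¹ + Wₓ W⁻¹`. Since `W` commutes with `C`, the first term
has the same trace against `C` as `J`, and the second contributes an exact derivative. -/
theorem IsDressing.pairing_momentum_eq {q : Fin 6 → Loop} {T T' : Seriesˣ} (h : IsDressing q T)
    (h' : IsDressing q T') {C : Series} (hC : IsHeis C) (k : ℤ) :
    pairing (momentum q T') C k = pairing (momentum q T) C k := by
  rw [pairing_eq h.momentum_mem_g2Series hC.mem_g2Series,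
    pairing_eq h'.momentum_mem_g2Series hC.mem_g2Series]
  refine congrArg (fun z : ℂ => 4 * z) ?_
  have hW1 : ((T' * T⁻¹ : Seriesˣ) : Series) - 1 ∈ filt Loop 1 := by
    have e : ((T' * T⁻¹ : Seriesˣ) : Series) - 1 =
        ((T' : Series) - 1) * (T⁻¹ : Seriesˣ) + (((T⁻¹ : Seriesˣ) : Series) - 1) := by
      rw [Units.val_mul]
      noncomm_ring
    rw [e]
    exact add_mem (mul_mem_filt' h'.sub_one_mem (inv_mem_filt h.sub_one_mem) (by omega))
      (inv_sub_one_mem_filt h.sub_one_mem)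
  have hWC : ((T' * T⁻¹ : Seriesˣ) : Series) * C = C * (T' * T⁻¹ : Seriesˣ) :=
    h.mul_inv_commute h' hC
  obtain ⟨r, hr⟩ := exists_trace_log_deriv_eq Loop.derivation hW1 (hC.derivSeries_eq_zero _) hWC k
  have hx := derivSeries_mul_inv_eq Loop.derivation (lax q) T T'
  rw [← Units.val_mul, ← momentum_eq, ← momentum_eq] at hx
  set W := T' * T⁻¹ with hW
  have e1 : momentum q T' * C = W * (momentum q T * C * (W⁻¹ : Seriesˣ)) +
      derivSeries Loop.derivation (W : Series) * (W⁻¹ : Seriesˣ) * C := by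
    have e2 : C * ((W⁻¹ : Seriesˣ) : Series) = (W⁻¹ : Seriesˣ) * C := by
      rw [Units.eq_inv_mul_iff_mul_eq, ← mul_assoc, hWC, mul_assoc, Units.mul_inv, mul_one]
    rw [hx, mul_assoc _ C, e2]
    simp only [sub_mul, ← mul_assoc, Units.mul_inv_cancel_right]
    abel
  rw [e1, HahnSeries.coeff_add, Matrix.trace_add, hr, Loop.integral_add,
    Loop.integral_derivation, add_zero, trace_coeff_mul_comm, Units.inv_mul_cancel_right]

/-! ## Laurent expansions -/

theorem casimir_mem_filt {T : Seriesˣ} (hT : (T : Series) - 1 ∈ filt Loop 1) {C : Series} {d : ℤ}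
    (hC : C ∈ filt Loop d) : casimir T C ∈ filt Loop d :=
  mul_mem_filt' (mul_mem_filt' (f := d) (inv_mem_filt hT) hC (by omega)) (mem_filt_of_sub_one hT)
    (by omega)

theorem coeff_casimir_lam_mul (T : Seriesˣ) (n k : ℤ) (C : Series) :
    (casimir T (lam n * C)).coeff k = (casimir T C).coeff (k + n) := by
  rw [← coeff_lamOver_mul, casimir, casimir, lam_eq, ← mul_assoc, ← lamOver_mul_comm, mul_assoc,
    mul_assoc, mul_assoc]

theorem LamPow_six_mul_add_one (n : ℤ) : LamPow (6 * n + 1) = lam n * Lam := by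
  rw [LamPow, if_pos (by omega)]
  congr 2
  omega

theorem LamPow_six_mul_sub_one (n : ℤ) : LamPow (6 * n - 1) = lam (n - 1) * Lam ^ 5 := by
  rw [LamPow, if_neg (by omega), if_pos (by omega)]
  congr 2
  omega

theorem coeff_casimir_LamPow_add_one (T : Seriesˣ) (n k : ℤ) :
    (casimir T (LamPow (6 * n + 1))).coeff k = (casimir T Lam).coeff (k + n) := by
  rw [LamPow_six_mul_add_one, coeff_casimir_lam_mul]

theorem coeff_casimir_LamPow_sub_one (T : Seriesˣ) (n k : ℤ) :
    (casimir T (LamPow (6 * n - 1))).coeff k = (casimir T (Lam ^ 5)).coeff (k + (n - 1)) := by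
  rw [LamPow_six_mul_sub_one, coeff_casimir_lam_mul]

/-! ## Change of coefficients -/

section Map

variable {R R' : Type*} [CommRing R] [Algebra ℂ R] [CommRing R'] [Algebra ℂ R']

/-- The map of Laurent series induced by a homomorphism of coefficient algebras. -/
def mapSeries (φ : R →ₐ[ℂ] R') : LaurentMat R →ₐ[ℂ] LaurentMat R' :=
  AlgHom.ofLinearMap
    { toFun X := X.map φ.toLinearMap.mapMatrix
      map_add' X Y := by
        ext1
        funext k
        exact map_add φ.toLinearMap.mapMatrix (X.coeff k) (Y.coeff k)
      map_smul' c X := by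
        ext1
        funext k
        exact map_smul φ.toLinearMap.mapMatrix c (X.coeff k) }
    (by
      ext1
      funext k
      change φ.toRingHom.mapMatrix (HahnSeries.coeff 1 k) = HahnSeries.coeff 1 k
      rw [HahnSeries.coeff_one, HahnSeries.coeff_one, apply_ite φ.toRingHom.mapMatrix, map_one,
        map_zero])
    (fun X Y => by
      obtain ⟨a, ha, hb⟩ := exists_coeff_eq_zero_of_lt₂ X Y
      have hm (Z : LaurentMat R) (hZ : ∀ k < a, Z.coeff k = 0) :
          ∀ k < a, (Z.map φ.toLinearMap.mapMatrix).coeff k = 0 := by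
        intro k hk
        change φ.toRingHom.mapMatrix (Z.coeff k) = 0
        rw [hZ k hk, map_zero]
      ext1
      funext k
      change φ.toRingHom.mapMatrix ((X * Y).coeff k) =
        (X.map φ.toLinearMap.mapMatrix * Y.map φ.toLinearMap.mapMatrix).coeff k
      rw [coeff_mul_eq_sum_Icc ha hb, coeff_mul_eq_sum_Icc (hm X ha) (hm Y hb), map_sum]
      exact Finset.sum_congr rfl fun i _ => map_mul φ.toRingHom.mapMatrix _ _)

variable (φ : R →ₐ[ℂ] R')

theorem coeff_mapSeries (X : LaurentMat R) (k : ℤ) :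
    (mapSeries φ X).coeff k = φ.toRingHom.mapMatrix (X.coeff k) := rfl

theorem trace_coeff_mapSeries (X : LaurentMat R) (k : ℤ) :
    ((mapSeries φ X).coeff k).trace = φ (X.coeff k).trace := by
  rw [coeff_mapSeries, Matrix.trace, Matrix.trace, map_sum]
  rfl

theorem mapSeries_mem_filt {X : LaurentMat R} {d : ℤ} (hX : X ∈ filt R d) :
    mapSeries φ X ∈ filt R' d := by
  intro k i j hk
  change φ (X.coeff k i j) = 0
  rw [hX k i j hk, map_zero]

theorem mapSeries_mem_g2Series {X : LaurentMat R} (hX : X ∈ g2Series R) :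
    mapSeries φ X ∈ g2Series R' := by
  intro k
  obtain ⟨h, e, f, hk⟩ := hX k
  rw [coeff_mapSeries, hk, map_g2Matrix]
  exact ⟨_, _, _, rfl⟩

theorem mapSeries_single (k : ℤ) (M : Matrix (Fin 7) (Fin 7) R) :
    mapSeries φ (HahnSeries.single k M) = HahnSeries.single k (φ.toRingHom.mapMatrix M) := by
  ext1
  funext m
  rw [coeff_mapSeries]
  by_cases h : m = k
  · rw [h, HahnSeries.coeff_single_same, HahnSeries.coeff_single_same]
  · rw [HahnSeries.coeff_single_of_ne h, HahnSeries.coeff_single_of_ne h, map_zero]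

theorem mapSeries_lamOver (n : ℤ) : mapSeries φ (lamOver R n) = lamOver R' n := by
  rw [lamOver, mapSeries_single, map_one, lamOver]

theorem mapSeries_LamOver : mapSeries φ (LamOver R) = LamOver R' := by
  have h0 {m : ℕ} : φ.toRingHom ∘ (0 : Fin m → R) = 0 := funext fun _ => map_zero φ
  have hB : φ.toRingHom ∘ ![1, 1, 0, 0, 0, 0] = ![1, 1, 0, 0, 0, 0] := by
    funext i
    fin_cases i <;> simp
  have hA : φ.toRingHom ∘ ![0, 0, 0, 0, 0, 1] = ![0, 0, 0, 0, 0, 1] := by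
    funext i
    fin_cases i <;> simp
  rw [LamOver, map_add, map_mul, mapSeries_lamOver, mapSeries_single, mapSeries_single,
    map_g2Matrix, map_g2Matrix, h0, h0, hA, hB, LamOver]

theorem mapSeries_LamPowOver (j : ℤ) : mapSeries φ (LamPowOver R j) = LamPowOver R' j := by
  rw [LamPowOver, LamPowOver]
  split_ifs
  · rw [map_mul, mapSeries_lamOver, mapSeries_LamOver]
  · rw [map_mul, map_pow, mapSeries_lamOver, mapSeries_LamOver]
  · exact map_zero _

theorem IsHeis.map {X : LaurentMat R} (hX : IsHeis X) : IsHeis (mapSeries φ X) := by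
  intro n
  obtain ⟨Y, hY, h⟩ := hX n
  refine ⟨mapSeries φ Y, ?_, by rw [← map_sub]; exact mapSeries_mem_filt φ h⟩
  have h1 := Submodule.mem_map_of_mem (f := (mapSeries φ).toLinearMap) hY
  rw [Submodule.map_span, ← Set.range_comp] at h1
  have h2 : (mapSeries φ).toLinearMap ∘ LamPowOver R = LamPowOver R' :=
    funext (mapSeries_LamPowOver φ)
  rwa [h2] at h1

theorem IsExpLim.map {U T : LaurentMat R} (hT : IsExpLim U T) :
    IsExpLim (mapSeries φ U) (mapSeries φ T) := by
  intro N
  have h := mapSeries_mem_filt φ (hT N)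
  have h2 : mapSeries φ (expTrunc U N) = expTrunc (mapSeries φ U) N := by
    rw [expTrunc, expTrunc, map_sum]
    exact Finset.sum_congr rfl fun n _ => by rw [map_smul, map_pow]
  rwa [map_sub, h2] at h

theorem mapSeries_derivSeries {δ : Derivation ℂ R R} {δ' : Derivation ℂ R' R'}
    (h : ∀ f, φ (δ f) = δ' (φ f)) (X : LaurentMat R) :
    mapSeries φ (derivSeries δ X) = derivSeries δ' (mapSeries φ X) := by
  ext1
  funext k
  ext1 i j
  exact h _

theorem mapSeries_gauge {δ : Derivation ℂ R R} {δ' : Derivation ℂ R' R'}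
    (h : ∀ f, φ (δ f) = δ' (φ f)) (L : LaurentMat R) (T : (LaurentMat R)ˣ) :
    mapSeries φ (gauge δ L T) =
      gauge δ' (mapSeries φ L) (Units.map (mapSeries φ : LaurentMat R →* LaurentMat R') T) := by
  rw [gauge, map_add, map_mul, map_mul, map_mul, mapSeries_derivSeries φ h]
  rfl

theorem mapMatrix_tangentOver (q : Fin 6 → R) :
    φ.toRingHom.mapMatrix (tangentOver q) = tangentOver (φ ∘ q) := by
  rw [tangentOver, map_g2Matrix, tangentOver]
  have h2 : φ 2 = 2 := map_ofNat φ 2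
  congr 1 <;> (funext i; fin_cases i <;> simp [h2])

end Map

/-! ## Smooth families of loops -/

/-- Smooth families of loops, as functions of the parameter and the point of the circle. -/
def Family : Subalgebra ℂ (ℝ × ℝ → ℂ) where
  carrier := {f | ContDiff ℝ ∞ f ∧ Function.Periodic f (0, 2 * Real.pi)}
  mul_mem' := fun ha hb => ⟨ha.1.mul hb.1, ha.2.mul hb.2⟩
  add_mem' := fun ha hb => ⟨ha.1.add hb.1, ha.2.add hb.2⟩
  algebraMap_mem' := fun _ => ⟨contDiff_const, fun _ => rfl⟩

theorem Family.differentiable (f : Family) : Differentiable ℝ (f : ℝ × ℝ → ℂ) :=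
  f.2.1.differentiable (by simp)

theorem Family.fderiv_apply_mem (f : Family) (v : ℝ × ℝ) :
    (fun p => fderiv ℝ (f : ℝ × ℝ → ℂ) p v) ∈ Family := by
  refine ⟨(f.2.1.fderiv_right (m := ∞) (by simp)).clm_apply contDiff_const, fun p => ?_⟩
  have h : (fun y => (f : ℝ × ℝ → ℂ) (y + (0, 2 * Real.pi))) = f := funext f.2.2
  change fderiv ℝ (f : ℝ × ℝ → ℂ) (p + (0, 2 * Real.pi)) v = fderiv ℝ (f : ℝ × ℝ → ℂ) p v
  rw [← fderiv_comp_add_right, h]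

/-- The derivative of families in the direction of `v`. -/
def Family.derivation (v : ℝ × ℝ) : Derivation ℂ Family Family :=
  Derivation.mk'
    { toFun f := ⟨fun p => fderiv ℝ (f : ℝ × ℝ → ℂ) p v, Family.fderiv_apply_mem f v⟩
      map_add' f g := by
        ext p
        change fderiv ℝ ((f : ℝ × ℝ → ℂ) + (g : ℝ × ℝ → ℂ)) p v = _
        rw [fderiv_add (Family.differentiable f p) (Family.differentiable g p)]
        rfl
      map_smul' c f := by
        ext p
        change fderiv ℝ (c • (f : ℝ × ℝ → ℂ)) p v = _
        rw [fderiv_const_smul (Family.differentiable f p)]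
        rfl }
    fun f g => by
      ext p
      change fderiv ℝ ((f : ℝ × ℝ → ℂ) * (g : ℝ × ℝ → ℂ)) p v =
        (f : ℝ × ℝ → ℂ) p * fderiv ℝ (g : ℝ × ℝ → ℂ) p v +
          (g : ℝ × ℝ → ℂ) p * fderiv ℝ (f : ℝ × ℝ → ℂ) p v
      rw [fderiv_mul (Family.differentiable f p) (Family.differentiable g p)]
      rfl

/-- Symmetry of the second derivative. -/
theorem Family.derivation_comm (v w : ℝ × ℝ) (f : Family) :
    Family.derivation v (Family.derivation w f) = Family.derivation w (Family.derivation v f) := by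
  ext p
  have hd : DifferentiableAt ℝ (fderiv ℝ (f : ℝ × ℝ → ℂ)) p :=
    (f.2.1.fderiv_right (m := ∞) (by simp)).differentiable (by simp) p
  have h (u u' : ℝ × ℝ) : (Family.derivation u (Family.derivation u' f) : ℝ × ℝ → ℂ) p =
      fderiv ℝ (fderiv ℝ (f : ℝ × ℝ → ℂ)) p u u' := by
    change fderiv ℝ (fun p => fderiv ℝ (f : ℝ × ℝ → ℂ) p u') p u = _
    rw [fderiv_clm_apply hd (differentiableAt_const _)]
    simp
  rw [h, h]
  exact (f.2.1.contDiffAt (x := p)).isSymmSndFDerivAt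
    (by rw [minSmoothness_of_isRCLikeNormedField]; exact
      WithTop.coe_le_coe.2 (le_top (a := (2 : ℕ∞)))) v w

/-- The loop at the parameter `t`. -/
def Family.evalHom (t : ℝ) : Family →ₐ[ℂ] Loop where
  toFun f := ⟨fun x => (f : ℝ × ℝ → ℂ) (t, x), f.2.1.comp (contDiff_const.prodMk contDiff_id),
    fun x => by simpa using f.2.2 (t, x)⟩
  map_one' := rfl
  map_mul' _ _ := rfl
  map_zero' := rfl
  map_add' _ _ := rfl
  commutes' _ := rfl

/-- The constant families. -/
def Family.constHom : Loop →ₐ[ℂ] Family where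
  toFun f := ⟨fun p => (f : ℝ → ℂ) p.2, f.2.1.comp contDiff_snd, fun p => by
    simpa using f.2.2 p.2⟩
  map_one' := rfl
  map_mul' _ _ := rfl
  map_zero' := rfl
  map_add' _ _ := rfl
  commutes' _ := rfl

theorem Family.evalHom_derivation (t : ℝ) (f : Family) :
    Family.evalHom t (Family.derivation (0, 1) f) = Loop.derivation (Family.evalHom t f) := by
  ext x
  have h := (Family.differentiable f (t, x)).hasFDerivAt.comp_hasDerivAt x
    ((hasDerivAt_const x t).prodMk (hasDerivAt_id x))
  exact h.deriv.symm

theorem Family.hasDerivAt (f : Family) (t x : ℝ) :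
    HasDerivAt (fun s => (f : ℝ × ℝ → ℂ) (s, x))
      ((Family.derivation (1, 0) f : ℝ × ℝ → ℂ) (t, x)) t :=
  (Family.differentiable f (t, x)).hasFDerivAt.comp_hasDerivAt t
    ((hasDerivAt_id t).prodMk (hasDerivAt_const t x))

theorem Family.hasDerivAt_integral (f : Family) (t : ℝ) :
    HasDerivAt (fun s => Loop.integral (Family.evalHom s f))
      (Loop.integral (Family.evalHom t (Family.derivation (1, 0) f))) t := by
  set g : Family := Family.derivation (1, 0) f with hg
  -- Compactness of a parameter interval times the period gives a constant bound for differentiation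
  -- under the integral.
  obtain ⟨b, hb⟩ := ((isCompact_Icc (a := t - 1) (b := t + 1)).prod
    (isCompact_uIcc (a := 0) (b := 2 * Real.pi))).exists_bound_of_continuousOn
      g.2.1.continuous.continuousOn
  refine (intervalIntegral.hasDerivAt_integral_of_dominated_loc_of_deriv_le
    (F := fun s x => (f : ℝ × ℝ → ℂ) (s, x)) (F' := fun s x => (g : ℝ × ℝ → ℂ) (s, x))
    (bound := fun _ => b) (Icc_mem_nhds (sub_one_lt t) (lt_add_one t)) ?_ ?_ ?_ ?_ ?_ ?_).2
  · exact Filter.Eventually.of_forall fun s =>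
      (Loop.continuous (Family.evalHom s f)).aestronglyMeasurable
  · exact (Loop.continuous (Family.evalHom t f)).intervalIntegrable _ _
  · exact (Loop.continuous (Family.evalHom t g)).aestronglyMeasurable
  · exact Filter.Eventually.of_forall fun x hx s hs => hb (s, x) ⟨hs, Set.uIoc_subset_uIcc hx⟩
  · exact intervalIntegrable_const
  · exact Filter.Eventually.of_forall fun x _ s _ => Family.hasDerivAt f s x

/-! ## The Hamiltonian -/

theorem derivSeries_single_tangentOver {R : Type*} [CommRing R] [Algebra ℂ R]
    (δ : Derivation ℂ R R) (k : ℤ) (q : Fin 6 → R) :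
    derivSeries δ (HahnSeries.single k (tangentOver q)) =
      HahnSeries.single k (tangentOver (δ ∘ q)) := by
  have h2 (a : R) : δ (2 * a) = 2 * δ a := by rw [two_mul, map_add, two_mul]
  have h : (δ : R →ₗ[ℂ] R).mapMatrix (tangentOver q) = tangentOver (δ ∘ q) := by
    rw [tangentOver, linearMap_mapMatrix_g2Matrix, tangentOver]
    congr 1 <;> (funext i; fin_cases i <;> simp [h2])
  ext1
  funext m
  rw [coeff_derivSeries]
  by_cases hm : m = k
  · rw [hm, HahnSeries.coeff_single_same, HahnSeries.coeff_single_same, h]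
  · rw [HahnSeries.coeff_single_of_ne hm, HahnSeries.coeff_single_of_ne hm, map_zero]

theorem mapSeries_evalHom_constHom (t : ℝ) (C : Series) :
    mapSeries (Family.evalHom t) (mapSeries Family.constHom C) = C := rfl

/-- Dressings chosen separately for each parameter need not vary smoothly. Dressing once over the
algebra of families gives a single `T` whose specializations are dressings. -/
theorem hasDerivAt_pairing_momentum {Q : Fin 6 → Family} {C : Series} (hC : IsHeis C) (k : ℤ) :
    ∃ T : ℝ → Seriesˣ, (∀ s, IsDressing (Family.evalHom s ∘ Q) (T s)) ∧
      ∀ t, HasDerivAt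
        (fun s => pairing (momentum (Family.evalHom s ∘ Q) (T s)) C k)
        (pairing (const (tangent (Family.evalHom t ∘ Family.derivation (1, 0) ∘ Q)))
          (casimir (T t) C) k) t := by
  set δ := Family.derivation (0, 1) with hδ
  set δ' := Family.derivation (1, 0) with hδ'
  set L : LaurentMat Family := HahnSeries.single 0 (tangentOver Q) + LamOver Family with hL
  have hLQ (s : ℝ) : mapSeries (Family.evalHom s) L = lax (Family.evalHom s ∘ Q) := by
    rw [hL, map_add, mapSeries_single, mapMatrix_tangentOver, mapSeries_LamOver, ← lax_sub_Lam,
      sub_add_cancel]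
  obtain ⟨U, hU, hU', T, hT, hJ, hJ'⟩ := exists_gauge_comm_eq_zero δ (L := L)
    (by rw [hL, add_sub_cancel_right]; exact single_tangentOver_mem_filt Q)
    (add_mem (single_tangentOver_mem_g2Series Q) LamOver_mem_g2Series)
  have hgauge (s : ℝ) : mapSeries (Family.evalHom s) (gauge δ L T) =
      momentum (Family.evalHom s ∘ Q)
        (Units.map (mapSeries (Family.evalHom s) : LaurentMat Family →* Series) T) := by
    rw [mapSeries_gauge (Family.evalHom s) (Family.evalHom_derivation s), hLQ, momentum_eq]
  have hdress (s : ℝ) : IsDressing (Family.evalHom s ∘ Q)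
      (Units.map (mapSeries (Family.evalHom s) : LaurentMat Family →* Series) T) := by
    refine isDressing_iff.2 ⟨⟨_, mapSeries_mem_filt (Family.evalHom s) hU,
      mapSeries_mem_g2Series (Family.evalHom s) hU', hT.map (Family.evalHom s)⟩,
      inHeisenberg_iff.2 ?_⟩
    have e : gauge Loop.derivation (lax (Family.evalHom s ∘ Q))
        (Units.map (mapSeries (Family.evalHom s) : LaurentMat Family →* Series) T) -
          LamOver Loop = mapSeries (Family.evalHom s) (gauge δ L T - LamOver Family) := by
      rw [map_sub, hgauge, mapSeries_LamOver, momentum_eq]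
    rw [e]
    refine ⟨mapSeries_mem_g2Series _ hJ, ?_⟩
    have h := congrArg (mapSeries (Family.evalHom s)) hJ'
    rwa [comm_apply, map_sub, map_mul, map_mul, mapSeries_LamOver, map_zero] at h
  refine ⟨_, hdress, fun t => ?_⟩
  -- The series `C` as a constant family, annihilated by both derivations.
  set D : LaurentMat Family := mapSeries Family.constHom C with hD
  have hDheis : IsHeis D := hC.map Family.constHom
  have hcomm : gauge δ L T * D = D * gauge δ L T := by
    refine hDheis.commute ?_
    rwa [map_sub, comm_apply _ (LamOver Family), sub_self, sub_zero] at hJ'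
  have key := deriv_trace_gauge_mul (Family.derivation_comm (0, 1) (1, 0)) L T
    (hDheis.derivSeries_eq_zero _) (hDheis.derivSeries_eq_zero _) hcomm k
  have hmain := (Family.hasDerivAt_integral ((gauge δ L T * D).coeff k).trace t).const_mul (4 : ℂ)
  -- The term `∂ₓ tr(Tₜ T⁻¹ C)` integrates to zero over the period, leaving only the variation of
  -- `S`.
  rw [key, map_add, Family.evalHom_derivation, Loop.integral_add, Loop.integral_derivation,
    add_zero, ← trace_coeff_mapSeries, map_mul] at hmain
  have h1 (s : ℝ) : pairing (momentum (Family.evalHom s ∘ Q)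
      (Units.map (mapSeries (Family.evalHom s) : LaurentMat Family →* Series) T)) C k =
        4 * Loop.integral (Family.evalHom s ((gauge δ L T * D).coeff k).trace) := by
    rw [pairing_eq (hdress s).momentum_mem_g2Series hC.mem_g2Series, ← trace_coeff_mapSeries,
      map_mul, hgauge, hD, mapSeries_evalHom_constHom]
  have h2 : mapSeries (Family.evalHom t) (derivSeries δ' L) =
      const (tangent (Family.evalHom t ∘ δ' ∘ Q)) := by
    rw [hL, map_add, derivSeries_LamOver, add_zero, derivSeries_single_tangentOver,
      mapSeries_single, mapMatrix_tangentOver]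
    rfl
  have h3 : mapSeries (Family.evalHom t) ((T⁻¹ : (LaurentMat Family)ˣ) * D * T) =
      casimir (Units.map (mapSeries (Family.evalHom t) : LaurentMat Family →* Series) T) C := by
    rw [map_mul, map_mul, hD, mapSeries_evalHom_constHom]
    rfl
  rw [h2, h3] at hmain
  simp only [h1]
  have h4 : const (tangent (Family.evalHom t ∘ δ' ∘ Q)) ∈ g2Series Loop :=
    single_tangentOver_mem_g2Series _
  rw [pairing_eq h4 ((hdress t).casimir_mem_g2Series hC.mem_g2Series)]
  exact hmain

end

end G2Loop

/-! ### Assembly of the proposition. -/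

theorem mainTheorem4 (c : ℤ → ℂ) (C : Series) (hC : IsHeisenbergSum c C) :
    -- `T` exists at every point of the symplectic leaf
    (∀ q : Fin 6 → Loop, ∃ T : Seriesˣ, IsDressing q T) ∧
    -- `V_C` has values in the Lie algebra and solves the Casimir equation
    (∀ (q : Fin 6 → Loop) (T : Seriesˣ), IsDressing q T →
      InG2 (casimir T C) ∧ dx (casimir T C) + ⁅casimir T C, lax q⁆ = 0) ∧
    -- `H_C = ⟨J, C⟩` is a well-defined function on the leaf, and its differential is `V_C`
    (InHeisenberg C ∧
      (∀ (q : Fin 6 → Loop) (T : Seriesˣ), IsDressing q T → InG2 (momentum q T)) ∧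
      ∃ ham : (Fin 6 → Loop) → ℤ → ℂ,
        (∀ (q : Fin 6 → Loop) (T : Seriesˣ), IsDressing q T →
          ham q = pairing (momentum q T) C) ∧
        ∀ q q' : ℝ → Fin 6 → Loop,
          (∀ i, ContDiff ℝ ∞ fun p : ℝ × ℝ => (q p.1 i : ℝ → ℂ) p.2) →
          (∀ i t x, HasDerivAt (fun s => (q s i : ℝ → ℂ) x) ((q' t i : ℝ → ℂ) x) t) →
          ∀ (t : ℝ) (T : Seriesˣ), IsDressing (q t) T → ∀ k : ℤ,
            HasDerivAt (fun s => ham (q s) k)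
              (pairing (const (tangent (q' t))) (casimir T C) k) t) ∧
    -- the Laurent expansions of `V^j`, `j = 6n + 1` and `j = 6n - 1`, with `V_j = res V^j`
    (∀ (q : Fin 6 → Loop) (T : Seriesˣ), IsDressing q T → ∀ n : ℤ,
      ((∀ p : ℤ, -2 ≤ p → (casimir T (LamPow (6 * n + 1))).coeff (p + 1 - n) =
            res (casimir T (LamPow (6 * p + 1)))) ∧
        ∀ p < (-2 : ℤ), (casimir T (LamPow (6 * n + 1))).coeff (p + 1 - n) = 0) ∧
      ((∀ p : ℤ, -2 ≤ p → (casimir T (LamPow (6 * n - 1))).coeff (p + 1 - n) =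
            res (casimir T (LamPow (6 * p - 1)))) ∧
        ∀ p < (-2 : ℤ), (casimir T (LamPow (6 * n - 1))).coeff (p + 1 - n) = 0)) := by
  have hH := isHeis_of_isHeisenbergSum hC
  refine ⟨exists_isDressing, fun q T hT => ⟨inG2_iff.2 (hT.casimir_mem_g2Series hH.mem_g2Series),
    hT.dx_casimir_add hH⟩, ⟨inHeisenberg_iff.2 ⟨hH.mem_g2Series, ?_⟩, fun q T hT =>
    inG2_iff.2 hT.momentum_mem_g2Series,
    -- Any choice of dressing at each point defines the Hamiltonian, because the pairing does not
    -- depend on it.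
    fun q => pairing (momentum q (exists_isDressing q).choose) C,
    fun q T hT => funext fun k => hT.pairing_momentum_eq (exists_isDressing q).choose_spec hH k,
    fun q q' hq hq' t T hT k => ?_⟩, fun q T hT n => ⟨⟨fun p _ => ?_, fun p hp => ?_⟩,
    ⟨fun p _ => ?_, fun p hp => ?_⟩⟩⟩
  · have h := hH.commute (Z := LamOver Loop) (by rw [comm_apply, sub_self])
    rw [comm_apply, h, sub_self]
  · let Q (i : Fin 6) : Family := ⟨fun p => (q p.1 i : ℝ → ℂ) p.2, hq i, fun p => by
      simpa using (q p.1 i).2.2 p.2⟩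
    have hQ (s : ℝ) : Family.evalHom s ∘ Q = q s := rfl
    have hQ' : Family.evalHom t ∘ Family.derivation (1, 0) ∘ Q = q' t := by
      funext i
      ext x
      exact (Family.hasDerivAt (Q i) t x).unique (hq' i t x)
    obtain ⟨T', hT', h⟩ := hasDerivAt_pairing_momentum (Q := Q) hH k
    have ht := h t
    rw [hQ'] at ht
    -- The given dressing at `t` and the specialization of the smooth family may differ, but they
    -- give the same `V_C`.
    rw [hT.casimir_eq (hT' t) hH] at ht
    convert ht using 1
    funext s
    exact (hT' s).pairing_momentum_eq (exists_isDressing (q s)).choose_spec hH k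
  · rw [res, coeff_casimir_LamPow_add_one, coeff_casimir_LamPow_add_one]
    congr 1
    omega
  · rw [coeff_casimir_LamPow_add_one]
    -- `T⁻¹ Λ T` has order `-1`, so its expansion stops at `λ¹`, which is the term `p = -2`.
    exact coeff_eq_zero_of_mem_filt (casimir_mem_filt hT.sub_one_mem LamOver_mem_filt) (by omega)
  · rw [res, coeff_casimir_LamPow_sub_one, coeff_casimir_LamPow_sub_one]
    congr 1
    omega
  · rw [coeff_casimir_LamPow_sub_one]
    -- The coefficient in question is that of `λ^(-p)` in `T⁻¹ Λ⁵ T`, a series of order `-5`; with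
    -- this sign even the term `p = -2` is zero.
    exact coeff_eq_zero_of_mem_filt (casimir_mem_filt hT.sub_one_mem LamOver_pow_five_mem_filt)
      (by omega)
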